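/- **Setting.** Base stations (BSs) form a homogeneous Poisson point process of density $\lambda_B>0$ in the plane; the typical user is at the origin. A BS at 2D distance $r$ from the user has 3D distance $w=\sqrt{r^2+L^2}$, where $L\ge 0$ is the constant antenna height difference. Given the BS positions, the links to the user are independently line-of-sight (LoS) with probability $\Pr^{\mathrm L}(r)=1-\frac{w}{d_1}$ if $w\le d_1$ and $\Pr^{\mathrm L}(r)=0$ if $w>d_1$, and non-line-of-sight (NLoS) otherwise ($d_1>0$). The path loss is $\zeta=A_{L}w^{-\alpha_{L}}$ for a LoS link and $\zeta=A_{NL}w^{-\alpha_{NL}}$ for a NLoS link, with positive constants $A_L,A_{NL},\alpha_L,\alpha_{NL}$. All BSs transmit with power $P_B>0$ through an antenna of vertical gain (in dB) $\max\{10\log_{10}|\cos^n(\theta-\theta_{tilt})|,F_{v2}\}+G_m$, $\theta=\arctan(L/r)$, horizontally omnidirectional; let $G$ be this gain in linear scale. The fading gains $g_i$ are i.i.d. exponential with mean one, independent of positions and link types. The user is served by the BS with the largest average received strength $P_B\zeta$ (neither fading nor antenna gain enters the association). The received powers are $P_BG_i\zeta_ig_i$; the signal $S$ (written $S^{L}$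 or $S^{NL}$ according to the type of the serving link) is the power received from the serving BS, $I_L$ and $I_N$ are the total powers received from the LoS and the NLoS BSs other than the serving one, and $N_0>0$ is the noise power. For $\gamma>0$ let $p^{\mathrm{cov}}(\lambda_B,\gamma)=\Pr\big[\frac{S}{I_L+I_N+N_0}>\gamma\big]$. **Theorem.** Almost surely a strongest BS exists. Let $R$ be the 2D distance of the serving BS. On the event that the serving link is LoS, $R$ has the (sub-probability) density $f_{R,1}^{L}$ on $[0,d_1]$ and does not exceed $d_1$; on the event that it is NLoS, $R$ has the density $f_{R,1}^{NL}$ on $[0,d_1]$ and $f_{R,2}^{NL}$ on $(d_1,\infty)$. Moreover $$p^{\mathrm{cov}}(\lambda_B,\gamma)=\int_0^{d_1}\Pr\Big[\tfrac{S^{L}}{I_L+I_N+N_0}>\gamma\,\Big|\,r\Big]f_{R,1}^{L}(r)\,dr+\int_0^{d_1}\Pr\Big[\tfrac{S^{NL}}{I_L+I_N+N_0}>\gamma\,\Big|\,r\Big]f_{R,1}^{NL}(r)\,dr+\int_{d_1}^{\infty}\Pr\Big[\tfrac{S^{NL}}{I_L+I_N+N_0}>\gamma\,\Big|\,r\Big]f_{R,2}^{NL}(r)\,dr,$$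 where the conditional probabilities are given that the serving link is LoS (first integral), respectively NLoS (second and third), and has 2D distance $r$. Here $$f_{R,1}^{L}(r)=\exp\Big(-\int_0^{r_1}(1-\Pr{}^{\mathrm L}(u))2\pi u\lambda_B\,du\Big)\exp\Big(-\int_0^{r}\Pr{}^{\mathrm L}(u)2\pi u\lambda_B\,du\Big)\Pr{}^{\mathrm L}(r)\,2\pi r\lambda_B,$$ $$f_{R,1}^{NL}(r)=\exp\Big(-\int_0^{r_2}\Pr{}^{\mathrm L}(u)2\pi u\lambda_B\,du\Big)\exp\Big(-\int_0^{r}(1-\Pr{}^{\mathrm L}(u))2\pi u\lambda_B\,du\Big)(1-\Pr{}^{\mathrm L}(r))\,2\pi r\lambda_B,$$ $$f_{R,2}^{NL}(r)=\exp\Big(-\int_0^{r_2}\Pr{}^{\mathrm L}(u)2\pi u\lambda_B\,du\Big)\exp\Big(-\int_0^{r}(1-\Pr{}^{\mathrm L}(u))2\pi u\lambda_B\,du\Big)2\pi r\lambda_B,$$ and $r_1,r_2\ge0$ are given by $$r_1^2=\Big(\frac{A_L}{A_{NL}}\Big)^{-\frac{2}{\alpha_{NL}}}(r^2+L^2)^{\frac{\alpha_L}{\alpha_{NL}}}-L^2,\qquad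 r_2^2=\Big(\frac{A_{NL}}{A_L}\Big)^{-\frac{2}{\alpha_L}}(r^2+L^2)^{\frac{\alpha_{NL}}{\alpha_L}}-L^2,$$ with $r_1=0$ (resp. $r_2=0$) when the right-hand side is negative. -/

import Mathlib

open MeasureTheory ProbabilityTheory Set
open scoped ENNReal

noncomputable section

/-- The plane in which the base stations (BSs) are deployed; the typical user is below its origin,
so the 2D distance from a BS at `x` to the user is `‖x‖`. -/
abbrev Plane : Type := EuclideanSpace ℝ (Fin 2)

/-- The deterministic parameters of the network. -/
structure NetParams where
  /-- BS density `λ_B` -/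
  lamB : ℝ
  /-- absolute antenna height difference `L` -/
  L : ℝ
  /-- 3D cut-off distance `d₁` of a LoS link -/
  d1 : ℝ
  /-- path loss at reference distance 1, LoS and NLoS -/
  AL : ℝ
  ANL : ℝ
  /-- path loss exponents, LoS and NLoS -/
  alphaL : ℝ
  alphaNL : ℝ
  /-- transmit power of a BS -/
  PB : ℝ
  /-- noise power -/
  N0 : ℝ
  /-- vertical antenna downtilt `θ_tilt` -/
  tilt : ℝ
  /-- exponent `n` of the vertical dipole pattern -/
  n : ℝ
  /-- vertical side-lobe level `F_v2`, in dB -/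
  Fv2 : ℝ
  /-- maximum antenna gain `G_m`, in dB -/
  Gm : ℝ
  lamB_pos : 0 < lamB
  L_nonneg : 0 ≤ L
  d1_pos : 0 < d1
  AL_pos : 0 < AL
  ANL_pos : 0 < ANL
  alphaL_pos : 0 < alphaL
  alphaNL_pos : 0 < alphaNL
  PB_pos : 0 < PB
  N0_pos : 0 < N0
  n_pos : 0 < n

namespace NetParams

variable (p : NetParams)

/-- 3D distance `w = √(r² + L²)` of a link with 2D distance `r`. -/
def dist3 (r : ℝ) : ℝ := Real.sqrt (r ^ 2 + p.L ^ 2)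

/-- LoS probability of a link with 2D distance `r`: linear in the 3D distance up to `d₁`. -/
def prL (r : ℝ) : ℝ := if p.dist3 r ≤ p.d1 then 1 - p.dist3 r / p.d1 else 0

/-- Path loss (gain) `ζ` at 2D distance `r`; the Boolean is `true` for LoS, `false` for NLoS. -/
def zeta (los : Bool) (r : ℝ) : ℝ :=
  if los then p.AL * p.dist3 r ^ (-p.alphaL) else p.ANL * p.dist3 r ^ (-p.alphaNL)

/-- Vertical antenna gain in dB at angle `θ`, i.e. `max {10 log₁₀ |cosⁿ(θ - θ_tilt)|, F_v2}`
with `log₁₀ 0 = -∞`. -/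
def gainVdB (θ : ℝ) : ℝ :=
  if Real.cos (θ - p.tilt) = 0 then p.Fv2
  else max (10 * Real.logb 10 (|Real.cos (θ - p.tilt)| ^ p.n)) p.Fv2

/-- Linear-scale 3D antenna gain towards a user at 2D distance `r`, seen under the angle
`θ = arctan (L / r)`; the horizontal gain is 0 dB (omnidirectional). -/
def gain (r : ℝ) : ℝ :=
  (10 : ℝ) ^ ((0 + p.gainVdB (Real.arctan (p.L / r)) + p.Gm) / 10)

/-- `r₁`: a NLoS BS is stronger than a LoS BS at distance `r` iff it is nearer than `r₁`.
It is `0` when the right-hand side of the equation for `r₁²` is negative. -/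
def r1 (r : ℝ) : ℝ :=
  Real.sqrt ((p.AL / p.ANL) ^ (-(2 / p.alphaNL)) * (r ^ 2 + p.L ^ 2) ^ (p.alphaL / p.alphaNL)
    - p.L ^ 2)

/-- `r₂`: a LoS BS is stronger than a NLoS BS at distance `r` iff it is nearer than `r₂`.
It is `0` when the right-hand side of the equation for `r₂²` is negative. -/
def r2 (r : ℝ) : ℝ :=
  Real.sqrt ((p.ANL / p.AL) ^ (-(2 / p.alphaL)) * (r ^ 2 + p.L ^ 2) ^ (p.alphaNL / p.alphaL)
    - p.L ^ 2)

/-- Probability that no LoS BS has 2D distance below `t`. -/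
def voidL (t : ℝ) : ℝ :=
  Real.exp (-∫ u in (0 : ℝ)..t, p.prL u * (2 * Real.pi * u * p.lamB))

/-- Probability that no NLoS BS has 2D distance below `t`. -/
def voidNL (t : ℝ) : ℝ :=
  Real.exp (-∫ u in (0 : ℝ)..t, (1 - p.prL u) * (2 * Real.pi * u * p.lamB))

/-- `f_{R,1}^L` -/
def fL1 (r : ℝ) : ℝ :=
  p.voidNL (p.r1 r) * p.voidL r * p.prL r * (2 * Real.pi * r * p.lamB)

/-- `f_{R,1}^NL` -/
def fNL1 (r : ℝ) : ℝ :=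
  p.voidL (p.r2 r) * p.voidNL r * (1 - p.prL r) * (2 * Real.pi * r * p.lamB)

/-- `f_{R,2}^NL` -/
def fNL2 (r : ℝ) : ℝ :=
  p.voidL (p.r2 r) * p.voidNL r * (2 * Real.pi * r * p.lamB)

end NetParams

/-- The number of points of the random sequence `X` in `B`, counted with multiplicity. -/
def pointCount {Ω : Type*} (X : ℕ → Ω → Plane) (B : Set Plane) (ω : Ω) : ℕ∞ :=
  {i : ℕ | X i ω ∈ B}.encard

/-- The points `X 0, X 1, …` form a homogeneous Poisson point process of intensity `lam`. -/
structure IsHPPP {Ω : Type*} [MeasurableSpace Ω] (P : Measure Ω) (X : ℕ → Ω → Plane) (lam : ℝ) :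
    Prop where
  measurable : ∀ i, Measurable (X i)
  poisson : ∀ B : Set Plane, MeasurableSet B → volume B ≠ ∞ → ∀ k : ℕ,
    P {ω | pointCount X B ω = k} = poissonMeasure (lam * (volume B).toReal).toNNReal {k}
  indep : ∀ (m : ℕ) (B : Fin m → Set Plane), (∀ k, MeasurableSet (B k)) →
    Pairwise (fun k l => Disjoint (B k) (B l)) → iIndepFun (fun k => pointCount X (B k)) P

/-- Random data of a network: for the `i`-th BS its position, whether its link to the typical user
is LoS, and the power gain of the fading on that link. -/
structure Network (Ω : Type*) where
  pos : ℕ → Ω → Plane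
  los : ℕ → Ω → Bool
  fading : ℕ → Ω → ℝ

/-- The law of the network: the BSs form an HPPP; given all positions, the links are independently
LoS with probability `Pr^L`; the fading gains are i.i.d. exponential with mean one (Rayleigh
fading), independent of positions and link states. -/
structure IsDownlinkNetwork {Ω : Type*} [MeasurableSpace Ω] (P : Measure Ω) (p : NetParams)
    (N : Network Ω) : Prop where
  hppp : IsHPPP P N.pos p.lamB
  measurable_los : ∀ i, Measurable (N.los i)
  law_los : ∀ (A : Set (ℕ → Plane)), MeasurableSet A → ∀ (s : Finset ℕ) (b : ℕ → Bool),
    P {ω | (fun i => N.pos i ω) ∈ A ∧ ∀ i ∈ s, N.los i ω = b i} =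
      ∫⁻ ω in {ω | (fun i => N.pos i ω) ∈ A},
        ∏ i ∈ s, ENNReal.ofReal (if b i then p.prL ‖N.pos i ω‖ else 1 - p.prL ‖N.pos i ω‖) ∂P
  measurable_fading : ∀ i, Measurable (N.fading i)
  law_fading : ∀ i, HasLaw (N.fading i) (expMeasure 1) P
  indep_fading : iIndepFun N.fading P
  indep_fading_geometry :
    IndepFun (fun ω i => N.fading i ω) (fun ω => (fun i => N.pos i ω, fun i => N.los i ω)) P

namespace Network

variable {Ω : Type*} (N : Network Ω) (p : NetParams)

/-- 2D distance of the `i`-th BS to the typical user. -/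
def dist (i : ℕ) (ω : Ω) : ℝ := ‖N.pos i ω‖

/-- Path loss (gain) of the `i`-th BS. -/
def linkZeta (i : ℕ) (ω : Ω) : ℝ := p.zeta (N.los i ω) (N.dist i ω)

/-- The `i`-th BS is a strongest one. All BSs transmit at the same power, and the association
averages the fading out and does not involve the antenna pattern, so the strength of a BS is
`P_B ζ`. -/
def IsStrongest (i : ℕ) (ω : Ω) : Prop :=
  ∀ j, p.PB * N.linkZeta p j ω ≤ p.PB * N.linkZeta p i ω

/-- The serving BS: the strongest one (ties, which have probability zero, are broken by the
index). -/
def serving (ω : Ω) : ℕ := sInf {i | N.IsStrongest p i ω}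

/-- The serving (2D) distance `R`. -/
def servDist (ω : Ω) : ℝ := N.dist (N.serving p ω) ω

/-- Whether the serving link is LoS. -/
def servLoS (ω : Ω) : Bool := N.los (N.serving p ω) ω

/-- Power received from the `i`-th BS. -/
def rxPower (i : ℕ) (ω : Ω) : ℝ :=
  p.PB * p.gain (N.dist i ω) * N.linkZeta p i ω * N.fading i ω

/-- Interference from the BSs, other than the serving one, whose link is LoS (`b = true`, `I_L`),
or NLoS (`b = false`, `I_N`). -/
def interf (b : Bool) (ω : Ω) : ℝ≥0∞ :=
  open Classical in
  ∑' i : ℕ, if i ≠ N.serving p ω ∧ N.los i ω = b then ENNReal.ofReal (N.rxPower p i ω) else 0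

/-- The signal power over a serving link of LoS type (`b = true`, `S^L`) or NLoS type
(`b = false`, `S^NL`). -/
def signal (b : Bool) (ω : Ω) : ℝ≥0∞ :=
  ENNReal.ofReal (p.PB * p.gain (N.servDist p ω) * p.zeta b (N.servDist p ω)
    * N.fading (N.serving p ω) ω)

/-- `S^L / (I_L + I_N + N₀)`, resp. `S^NL / (I_L + I_N + N₀)`. -/
def sinrOf (b : Bool) (ω : Ω) : ℝ≥0∞ :=
  N.signal p b ω / (N.interf p true ω + N.interf p false ω + ENNReal.ofReal p.N0)

/-- The SINR of the typical user: the power received from the serving BS over the power received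
from all other BSs plus noise (zero if the total interference is infinite). -/
def sinr (ω : Ω) : ℝ≥0∞ :=
  open Classical in
  ENNReal.ofReal (N.rxPower p (N.serving p ω) ω) /
    ((∑' i : ℕ, if i ≠ N.serving p ω then ENNReal.ofReal (N.rxPower p i ω) else 0)
      + ENNReal.ofReal p.N0)

/-- The coverage probability `Pr[SINR > γ]`. -/
def pcov [MeasurableSpace Ω] (P : Measure Ω) (γ : ℝ) : ℝ≥0∞ :=
  P {ω | ENNReal.ofReal γ < N.sinr p ω}

/-- `Pr[S^b / (I_L + I_N + N₀) > γ | r]`: the (regular) conditional probability given that the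
serving link has type `b` and distance `r`. -/
def condCov [MeasurableSpace Ω] (P : Measure Ω) [IsFiniteMeasure P] (γ : ℝ) (b : Bool) (r : ℝ) :
    ℝ≥0∞ :=
  condDistrib (N.sinrOf p b) (fun ω => (N.servDist p ω, N.servLoS p ω)) P (r, b)
    (Ioi (ENNReal.ofReal γ))

end Network

end

/-! Given the positions, the link types are independent marks, so the LoS and the NLoS BSs behave
like two independent Poisson processes with intensities `lamB * prL` and `lamB * (1 - prL)`. Within
one type the path loss decreases strictly with distance, so the strongest BS is the nearest BS of
its type. It beats the other type exactly when no BS of that type lies closer than the crossover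
distance `r1` or `r2`. The density of the serving distance is therefore the density of the nearest
BS of the type times the void probability of the other type up to the crossover.

The independence comes from avoidance probabilities. If points of type `b` must avoid `K b`,
averaging over the types gives the expectation of `∏ (1 - g (X i))`, where `g x` is the probability
that a point at `x` violates its constraint. The generating functional of the Poisson process
evaluates it (`IsHPPP.lintegral_retentionProd`, `IsDownlinkNetwork.measure_avoid`). With balls for
`K b`, the joint tail of the two nearest distances factorizes, which gives
`IsDownlinkNetwork.indepFun_nearest`. Fubini then yields the law of the serving distance and type;
ties are null because the finite part of each nearest distance has a density.

The coverage formula disintegrates the coverage event along the serving distance on each type.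
Beyond `d1` the LoS probability vanishes, which accounts for the split into three integrals. -/

noncomputable section

/-! ### Generating functional of the Poisson process -/

/-- The exponential series at `m * (1 - c)`, damped by `exp (-m)`. It supplies the factor of one
level set in the generating functional. -/
theorem tsum_poissonMeasure_mul_pow {m : ℝ} (hm : 0 ≤ m) {c : ℝ≥0∞} (hc : c ≤ 1) :
    ∑' k : ℕ, poissonMeasure m.toNNReal {k} * (1 - c) ^ k =
      ENNReal.ofReal (Real.exp (-(m * c.toReal))) := by
  have hc' : c ≠ ∞ := ne_top_of_le_ne_top ENNReal.one_ne_top hc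
  have h1 : (1 - c) = ENNReal.ofReal (1 - c.toReal) := by
    rw [ENNReal.ofReal_sub _ ENNReal.toReal_nonneg, ENNReal.ofReal_toReal hc', ENNReal.ofReal_one]
  have hx : 0 ≤ 1 - c.toReal := by
    have := ENNReal.toReal_mono ENNReal.one_ne_top hc
    simp at this; linarith
  have hs : HasSum (fun k : ℕ => Real.exp (-m) * m ^ k / (k.factorial : ℝ) * (1 - c.toReal) ^ k)
      (Real.exp (-(m * c.toReal))) := by
    have := (NormedSpace.expSeries_div_hasSum_exp (m * (1 - c.toReal))).mul_left (Real.exp (-m))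
    rw [← Real.exp_eq_exp_ℝ, ← Real.exp_add] at this
    convert! this using 1
    · ext k; rw [mul_pow]; ring
    · congr 1; ring
  rw [← hs.tsum_eq, ENNReal.ofReal_tsum_of_nonneg (fun k => by positivity) hs.summable]
  refine tsum_congr fun k => ?_
  rw [poissonMeasure_singleton, h1, ← ENNReal.ofReal_pow hx, ← ENNReal.ofReal_mul (by positivity),
    Real.coe_toNNReal _ hm]

section

variable {Ω : Type*} {X : ℕ → Ω → Plane}

/-- The infinite product `∏ᵢ (1 - g (Xᵢ))`. -/
def retentionProd (X : ℕ → Ω → Plane) (g : Plane → ℝ≥0∞) (ω : Ω) : ℝ≥0∞ :=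
  ⨅ n : ℕ, ∏ i ∈ Finset.range n, (1 - g (X i ω))

theorem antitone_prod_one_sub (u : ℕ → ℝ≥0∞) :
    Antitone fun n : ℕ => ∏ i ∈ Finset.range n, (1 - u i) := by
  refine antitone_nat_of_succ_le fun n => ?_
  rw [Finset.prod_range_succ]
  exact mul_le_of_le_one_right' tsub_le_self

theorem prod_one_sub_le_one (u : ℕ → ℝ≥0∞) (n : ℕ) :
    ∏ i ∈ Finset.range n, (1 - u i) ≤ 1 :=
  Finset.prod_le_one' fun _ _ => tsub_le_self

/-- Factors with `g = 0` equal one, so finitely many indices matter, and grouping them by the value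
of `g` leaves a function of finitely many counts over disjoint sets. This is the form to which the
Poisson hypotheses apply. -/
theorem retentionProd_simpleFunc (g : SimpleFunc Plane ℝ≥0∞) {ω : Ω}
    (hfin : ∀ c ∈ g.range.filter (· ≠ 0), pointCount X (g ⁻¹' {c}) ω ≠ ⊤) :
    retentionProd X g ω =
      ∏ c ∈ g.range.filter (· ≠ 0), (1 - c) ^ (pointCount X (g ⁻¹' {c}) ω).toNat := by
  have hf : ∀ c ∈ g.range.filter (· ≠ 0), {i : ℕ | g (X i ω) = c}.Finite := fun c hc =>
    encard_ne_top_iff.1 (hfin c hc)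
  have hU : (⋃ c ∈ g.range.filter (· ≠ 0), {i : ℕ | g (X i ω) = c}).Finite :=
    Set.Finite.biUnion (Finset.finite_toSet _) hf
  -- Every index with a nonzero value of `g` is at most `M`, so the partial products are constant
  -- past `M`.
  obtain ⟨M, hM⟩ := hU.bddAbove
  have key : ∀ n, M < n → ∏ i ∈ Finset.range n, (1 - g (X i ω)) =
      ∏ c ∈ g.range.filter (· ≠ 0), (1 - c) ^ (pointCount X (g ⁻¹' {c}) ω).toNat := by
    intro n hn
    have h1 : ∏ i ∈ Finset.range n, (1 - g (X i ω)) =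
        ∏ i ∈ (Finset.range n).filter (fun i => g (X i ω) ≠ 0), (1 - g (X i ω)) := by
      rw [Finset.prod_filter]
      refine Finset.prod_congr rfl fun i _ => ?_
      split_ifs with h
      · rfl
      · rw [not_not.1 h, tsub_zero]
    rw [h1, ← Finset.prod_fiberwise_of_maps_to (t := g.range.filter (· ≠ 0))
      (g := fun i => g (X i ω)) (fun i hi => by
        simp only [Finset.mem_filter] at hi ⊢
        exact ⟨g.mem_range_self _, hi.2⟩)]
    refine Finset.prod_congr rfl fun c hc => ?_
    have hc0 : c ≠ 0 := (Finset.mem_filter.1 hc).2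
    rw [Finset.prod_congr rfl (g := fun _ => 1 - c)
      (fun i hi => by rw [(Finset.mem_filter.1 hi).2]), Finset.prod_const]
    congr 1
    have : {i : ℕ | X i ω ∈ g ⁻¹' {c}} = ((Finset.range n).filter
        (fun i => g (X i ω) ≠ 0)).filter (fun i => g (X i ω) = c) := by
      ext i
      simp only [mem_preimage, mem_singleton_iff, mem_ofPred_eq, Finset.coe_filter,
        Finset.mem_filter, Finset.mem_range]
      refine ⟨fun hi => ⟨⟨lt_of_le_of_lt (hM ?_) hn, hi ▸ hc0⟩, hi⟩, fun hi => hi.2⟩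
      exact mem_biUnion hc hi
    rw [pointCount, this, encard_coe_eq_coe_finsetCard, ENat.toNat_natCast]
  refine le_antisymm ((iInf_le _ (M + 1)).trans_eq (key _ (Nat.lt_succ_self M))) ?_
  refine le_iInf fun n => ?_
  rw [← key (max n (M + 1)) (lt_max_of_lt_right (Nat.lt_succ_self M))]
  exact antitone_prod_one_sub (fun i => g (X i ω)) (le_max_left _ _)

theorem retentionProd_le_one (g : Plane → ℝ≥0∞) (ω : Ω) : retentionProd X g ω ≤ 1 :=
  (iInf_le _ 0).trans (prod_one_sub_le_one _ 0)

variable [MeasurableSpace Ω]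

/-- There are at least `k` points in `B` iff some index set of size `k` is mapped into `B`, and
there are only countably many such sets. -/
theorem measurable_pointCount (hX : ∀ i, Measurable (X i)) {B : Set Plane} (hB : MeasurableSet B) :
    Measurable (pointCount X B) := by
  have h : ∀ k : ℕ, MeasurableSet {ω | (k : ℕ∞) ≤ pointCount X B ω} := by
    intro k
    have : {ω | (k : ℕ∞) ≤ pointCount X B ω} =
        ⋃ s ∈ {s : Finset ℕ | s.card = k}, ⋂ i ∈ s, X i ⁻¹' B := by
      ext ω
      simp only [mem_ofPred_eq, mem_iUnion, mem_iInter, mem_preimage, pointCount]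
      constructor
      · intro h
        obtain ⟨t, ht, htk⟩ := exists_subset_encard_eq h
        have hfin : t.Finite := finite_of_encard_eq_coe htk
        refine ⟨hfin.toFinset, ?_, fun i hi => ht (hfin.mem_toFinset.1 hi)⟩
        rw [hfin.encard_eq_coe_toFinset_card] at htk
        exact_mod_cast htk
      · rintro ⟨s, hs, h⟩
        rw [← hs, ← encard_coe_eq_coe_finsetCard]
        exact encard_le_encard fun i hi => h i hi
    rw [this]
    exact MeasurableSet.biUnion (to_countable _) fun s _ =>
      MeasurableSet.biInter (to_countable _) fun i _ => hX i hB
  refine measurable_to_countable' fun k => ?_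
  have hlt : ∀ n : ℕ, MeasurableSet {ω | pointCount X B ω < n} := fun n => by
    convert (h n).compl using 1; ext; simp
  induction k using ENat.recTopCoe with
  | top =>
    have : pointCount X B ⁻¹' {⊤} = ⋂ n : ℕ, {ω | (n : ℕ∞) ≤ pointCount X B ω} := by
      ext ω
      simp only [mem_preimage, mem_singleton_iff, mem_iInter, mem_ofPred_eq]
      exact ⟨fun h n => h ▸ le_top, fun h => ENat.eq_top_iff_forall_ge.2 h⟩
    rw [this]; exact MeasurableSet.iInter h
  | coe n =>
    have : pointCount X B ⁻¹' {(n : ℕ∞)} =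
        {ω | (n : ℕ∞) ≤ pointCount X B ω} ∩ {ω | pointCount X B ω < (n + 1 : ℕ)} := by
      ext ω
      simp only [mem_preimage, mem_singleton_iff, mem_inter_iff, mem_ofPred_eq]
      constructor
      · rintro h; rw [h]; exact ⟨le_rfl, by exact_mod_cast Nat.lt_succ_self n⟩
      · rintro ⟨h1, h2⟩
        refine le_antisymm ?_ h1
        push_cast at h2
        exact ENat.lt_natCast_add_one_iff.1 h2
    rw [this]; exact (h n).inter (hlt _)

theorem measurable_retentionProd (hX : ∀ i, Measurable (X i)) {g : Plane → ℝ≥0∞}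
    (hg : Measurable g) : Measurable (retentionProd X g) :=
  Measurable.iInf fun _ => Finset.measurable_fun_prod _ fun i _ =>
    measurable_const.sub (hg.comp (hX i))

variable {P : Measure Ω} {lam : ℝ}

theorem IsHPPP.iIndepFun_pointCount (h : IsHPPP P X lam) {ι : Type*} [Fintype ι]
    (B : ι → Set Plane) (hB : ∀ k, MeasurableSet (B k))
    (hd : Pairwise fun k l => Disjoint (B k) (B l)) :
    iIndepFun (fun k => pointCount X (B k)) P := by
  have e := Fintype.equivFin ι
  have := h.indep _ (fun k => B (e.symm k)) (fun k => hB _)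
    (fun k l hkl => hd fun h => hkl (e.symm.injective h))
  simpa using iIndepFun.precomp e.injective this

variable [IsProbabilityMeasure P]

/-- The Poisson weights of the finite counts already sum to one, which leaves no mass for `⊤`. -/
theorem IsHPPP.ae_pointCount_ne_top (h : IsHPPP P X lam) {B : Set Plane} (hB : MeasurableSet B)
    (hv : volume B ≠ ∞) : ∀ᵐ ω ∂P, pointCount X B ω ≠ ⊤ := by
  have hm : ∀ k : ℕ, MeasurableSet {ω | pointCount X B ω = k} := fun k =>
    measurable_pointCount h.measurable hB (measurableSet_singleton _)
  have hU : P (⋃ k : ℕ, {ω | pointCount X B ω = k}) = 1 := by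
    rw [measure_iUnion _ hm]
    · simp_rw [h.poisson B hB hv]
      rw [← measure_univ (μ := poissonMeasure (lam * (volume B).toReal).toNNReal),
        ← iUnion_of_singleton ℕ, measure_iUnion _ (fun _ => measurableSet_singleton _)]
      exact fun i j hij => by simpa using hij
    · intro i j hij
      refine disjoint_left.2 fun ω h1 h2 => hij ?_
      have : (i : ℕ∞) = j := h1.symm.trans h2
      exact_mod_cast this
  rw [← prob_compl_eq_zero_iff (MeasurableSet.iUnion hm)] at hU
  filter_upwards [measure_eq_zero_iff_ae_notMem.1 hU] with ω hω ht
  apply hω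
  simp [ht]

theorem IsHPPP.lintegral_pow_pointCount (h : IsHPPP P X lam) (hlam : 0 ≤ lam) {B : Set Plane}
    (hB : MeasurableSet B) (hv : volume B ≠ ∞) {c : ℝ≥0∞} (hc : c ≤ 1) :
    ∫⁻ ω, (1 - c) ^ (pointCount X B ω).toNat ∂P =
      ENNReal.ofReal (Real.exp (-(lam * (volume B).toReal * c.toReal))) := by
  have hm : ∀ k : ℕ, MeasurableSet {ω | pointCount X B ω = k} := fun k =>
    measurable_pointCount h.measurable hB (measurableSet_singleton _)
  -- Only almost everywhere: at an infinite count `toNat` is 0, so the left side is 1 while the sum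
  -- is 0.
  have he : ∀ᵐ ω ∂P, (1 - c) ^ (pointCount X B ω).toNat =
      ∑' k : ℕ, {ω | pointCount X B ω = k}.indicator (fun _ => (1 - c) ^ k) ω := by
    filter_upwards [h.ae_pointCount_ne_top hB hv] with ω hω
    obtain ⟨n, hn⟩ := ENat.ne_top_iff_exists.1 hω
    rw [tsum_eq_single n]
    · simp [← hn]
    · intro k hk
      rw [indicator_of_notMem]
      simp only [mem_ofPred_eq, ← hn]
      exact_mod_cast hk.symm
  rw [lintegral_congr_ae he, lintegral_tsum fun k =>
    (measurable_const.indicator (hm k)).aemeasurable]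
  simp_rw [lintegral_indicator_const (hm _), h.poisson B hB hv, mul_comm ((1 - c) ^ _)]
  exact tsum_poissonMeasure_mul_pow (by positivity) hc

/-- The level sets of nonzero values are disjoint and, by integrability, of finite area, so their
counts are independent Poisson variables and the expectation factorizes. The value 0 has to be left
out because its level set has infinite area. -/
theorem IsHPPP.lintegral_retentionProd_simpleFunc (h : IsHPPP P X lam) (hlam : 0 ≤ lam)
    (g : SimpleFunc Plane ℝ≥0∞) (hg : ∀ x, g x ≤ 1) (hint : ∫⁻ x, g x ≠ ∞) :
    ∫⁻ ω, retentionProd X g ω ∂P =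
      ENNReal.ofReal (Real.exp (-(lam * (∫⁻ x, g x).toReal))) := by
  set S := g.range.filter (· ≠ 0) with hS
  have hsum : ∫⁻ x, g x = ∑ c ∈ S, c * volume (g ⁻¹' {c}) := by
    rw [SimpleFunc.lintegral_eq_lintegral, SimpleFunc.lintegral, hS, Finset.sum_filter_of_ne]
    intro c _ hc h0
    simp [h0] at hc
  have hc0 : ∀ c ∈ S, c ≠ 0 := fun c hc => (Finset.mem_filter.1 hc).2
  have hc1 : ∀ c ∈ S, c ≤ 1 := fun c hc => by
    obtain ⟨x, rfl⟩ := SimpleFunc.mem_range.1 (Finset.mem_filter.1 hc).1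
    exact hg x
  have hterm : ∀ c ∈ S, c * volume (g ⁻¹' {c}) ≠ ∞ := fun c hc =>
    ne_top_of_le_ne_top (hsum ▸ hint)
      (Finset.single_le_sum (f := fun c => c * volume (g ⁻¹' {c})) (fun _ _ => zero_le) hc)
  have hvol : ∀ c ∈ S, volume (g ⁻¹' {c}) ≠ ∞ := fun c hc htop =>
    hterm c hc (by rw [htop, ENNReal.mul_top (hc0 c hc)])
  have hB : ∀ c, MeasurableSet (g ⁻¹' {c}) := g.measurableSet_fiber
  have hae : ∀ᵐ ω ∂P, ∀ c ∈ S, pointCount X (g ⁻¹' {c}) ω ≠ ⊤ :=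
    (ae_ball_iff (Finset.countable_toSet S)).2 fun c hc => h.ae_pointCount_ne_top (hB c) (hvol c hc)
  rw [lintegral_congr_ae (g := fun ω => ∏ c : S, (1 - c.1) ^ (pointCount X (g ⁻¹' {c.1}) ω).toNat)]
  · have hind := h.iIndepFun_pointCount (fun c : S => g ⁻¹' {c.1}) (fun c => hB _)
      (fun c d hcd => by
        refine disjoint_left.2 fun x hx hy => hcd (Subtype.ext ?_)
        exact (mem_singleton_iff.1 hx).symm.trans hy)
    have hind' := hind.comp (fun (c : S) (k : ℕ∞) => (1 - c.1) ^ k.toNat)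
      (fun c => Measurable.of_discrete)
    have := lintegral_prod_eq_prod_lintegral_of_indepFun Finset.univ _ hind'
      (fun c => (Measurable.of_discrete (f := fun k : ℕ∞ => (1 - c.1) ^ k.toNat)).comp
        (measurable_pointCount h.measurable (hB c.1)))
    simp only [Function.comp_apply] at this
    rw [this, Finset.prod_congr rfl fun c _ =>
      h.lintegral_pow_pointCount hlam (hB c.1) (hvol c.1 c.2) (hc1 c.1 c.2),
      ← ENNReal.ofReal_prod_of_nonneg (fun _ _ => (Real.exp_pos _).le), ← Real.exp_sum, hsum,
      ENNReal.toReal_sum hterm, Finset.mul_sum, ← Finset.sum_neg_distrib, ← Finset.sum_coe_sort S]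
    congr 2
    refine Finset.sum_congr rfl fun c _ => ?_
    rw [ENNReal.toReal_mul]; ring
  · filter_upwards [hae] with ω hω
    rw [retentionProd_simpleFunc g hω]
    exact (Finset.prod_coe_sort S fun c => (1 - c) ^ (pointCount X (g ⁻¹' {c}) ω).toNat).symm

/-- The generating functional of a homogeneous Poisson point process. -/
theorem IsHPPP.lintegral_retentionProd (h : IsHPPP P X lam) (hlam : 0 ≤ lam)
    {g : Plane → ℝ≥0∞} (hgm : Measurable g) (hg : ∀ x, g x ≤ 1) (hint : ∫⁻ x, g x ≠ ∞) :
    ∫⁻ ω, retentionProd X g ω ∂P =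
      ENNReal.ofReal (Real.exp (-(lam * (∫⁻ x, g x).toReal))) := by
  -- Simple functions increase to `g`, so the products decrease and are bounded by one; monotone
  -- convergence applies to both sides.
  set s := SimpleFunc.eapprox g
  have hmono : ∀ x, Monotone fun n => s n x := fun x m n hmn => SimpleFunc.monotone_eapprox g hmn x
  have hsup : ∀ x, ⨆ n, s n x = g x := fun x => SimpleFunc.iSup_eapprox_apply hgm x
  have hle : ∀ n x, s n x ≤ g x := fun n x => hsup x ▸ le_iSup (fun n => s n x) n
  have hlim : ∀ x, Filter.Tendsto (fun n => s n x) Filter.atTop (nhds (g x)) := fun x =>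
    hsup x ▸ tendsto_atTop_iSup (hmono x)
  -- The infimum over the length of the product and the one over the approximation commute, and a
  -- product of fixed finite length is continuous in its factors.
  have hprod : ∀ ω, retentionProd X g ω = ⨅ n, retentionProd X (s n) ω := by
    intro ω
    unfold retentionProd
    rw [iInf_comm]
    refine iInf_congr fun n => ?_
    have hanti : Antitone fun m => ∏ i ∈ Finset.range n, (1 - s m (X i ω)) := fun a b hab =>
      Finset.prod_le_prod' fun i _ => tsub_le_tsub_left (hmono _ hab) _
    refine tendsto_nhds_unique ?_ (tendsto_atTop_iInf hanti)
    have : ∀ t : Finset ℕ, Filter.Tendsto (fun m => ∏ i ∈ t, (1 - s m (X i ω))) Filter.atTop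
        (nhds (∏ i ∈ t, (1 - g (X i ω)))) := by
      intro t
      induction t using Finset.induction_on with
      | empty => simp
      | insert a t ha ih =>
        simp_rw [Finset.prod_insert ha]
        refine ENNReal.Tendsto.mul (ENNReal.Tendsto.sub tendsto_const_nhds (hlim _)
          (Or.inl ENNReal.one_ne_top)) (Or.inr ?_) ih (Or.inr ?_)
        · exact ne_top_of_le_ne_top ENNReal.one_ne_top
            (Finset.prod_le_one' fun _ _ => tsub_le_self)
        · exact ne_top_of_le_ne_top ENNReal.one_ne_top tsub_le_self
    exact this _
  have hintn : ∀ n, ∫⁻ x, s n x ≠ ∞ := fun n =>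
    ne_top_of_le_ne_top hint (lintegral_mono (hle n))
  have hantiP : Antitone fun n => retentionProd X (s n) := fun a b hab ω =>
    iInf_mono fun n => Finset.prod_le_prod' fun i _ => tsub_le_tsub_left (hmono _ hab) _
  have hmeas : ∀ n, Measurable (retentionProd X (s n)) := fun n =>
    measurable_retentionProd h.measurable (s n).measurable
  have hL : Filter.Tendsto (fun n => ∫⁻ ω, retentionProd X (s n) ω ∂P) Filter.atTop
      (nhds (∫⁻ ω, retentionProd X g ω ∂P)) := by
    simp_rw [hprod]
    rw [lintegral_iInf hmeas hantiP]
    · exact tendsto_atTop_iInf fun a b hab => lintegral_mono (hantiP hab)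
    · exact ne_top_of_le_ne_top ENNReal.one_ne_top
        ((lintegral_mono fun ω => retentionProd_le_one _ ω).trans_eq (by simp))
  have hR : Filter.Tendsto (fun n => ENNReal.ofReal (Real.exp (-(lam * (∫⁻ x, s n x).toReal))))
      Filter.atTop (nhds (ENNReal.ofReal (Real.exp (-(lam * (∫⁻ x, g x).toReal))))) := by
    have h1 : Filter.Tendsto (fun n => ∫⁻ x, s n x) Filter.atTop (nhds (∫⁻ x, g x)) :=
      lintegral_tendsto_of_tendsto_of_monotone (fun n => (s n).measurable.aemeasurable)
        (Filter.Eventually.of_forall hmono) (Filter.Eventually.of_forall hlim)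
    have h2 := (ENNReal.tendsto_toReal hint).comp h1
    exact ENNReal.tendsto_ofReal
      ((Real.continuous_exp.tendsto _).comp ((h2.const_mul lam).neg))
  refine tendsto_nhds_unique hL (hR.congr fun n => ?_)
  exact (h.lintegral_retentionProd_simpleFunc hlam (s n) (fun x => (hle n x).trans (hg x))
    (hintn n)).symm

end

/-! ### Link-type probabilities and radial integrals -/

namespace NetParams

variable (p : NetParams)

/-- Probability that a link with 2D distance `r` has the given type. -/
def prLink (b : Bool) (r : ℝ) : ℝ := if b then p.prL r else 1 - p.prL r

/-- Probability that no BS with a link of type `b` has 2D distance below `t`. -/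
def voidLink (b : Bool) (t : ℝ) : ℝ :=
  Real.exp (-∫ u in (0 : ℝ)..t, p.prLink b u * (2 * Real.pi * u * p.lamB))

theorem voidLink_true (t : ℝ) : p.voidLink true t = p.voidL t := by simp [voidLink, voidL, prLink]

theorem voidLink_false (t : ℝ) : p.voidLink false t = p.voidNL t := by
  simp [voidLink, voidNL, prLink]

theorem dist3_nonneg (r : ℝ) : 0 ≤ p.dist3 r := Real.sqrt_nonneg _

theorem continuous_dist3 : Continuous p.dist3 := by unfold dist3; fun_prop

theorem prL_eq_max (r : ℝ) : p.prL r = max 0 (1 - p.dist3 r / p.d1) := by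
  unfold prL
  split_ifs with h
  · rw [max_eq_right]; rw [sub_nonneg]; exact (div_le_one p.d1_pos).2 h
  · rw [max_eq_left]; rw [sub_nonpos]; exact (one_le_div p.d1_pos).2 (not_le.1 h).le

theorem continuous_prL : Continuous p.prL := by
  have : p.prL = fun r => max 0 (1 - p.dist3 r / p.d1) := funext p.prL_eq_max
  rw [this]
  exact continuous_const.max (continuous_const.sub (p.continuous_dist3.div_const _))

theorem prL_nonneg (r : ℝ) : 0 ≤ p.prL r := by rw [prL_eq_max]; exact le_max_left _ _

theorem prL_le_one (r : ℝ) : p.prL r ≤ 1 := by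
  rw [prL_eq_max]
  exact max_le zero_le_one (sub_le_self _ (div_nonneg (p.dist3_nonneg r) p.d1_pos.le))

theorem continuous_prLink (b : Bool) : Continuous (p.prLink b) := by
  cases b
  · have : p.prLink false = fun r => 1 - p.prL r := by ext; simp [prLink]
    rw [this]; exact continuous_const.sub p.continuous_prL
  · have : p.prLink true = p.prL := by ext; simp [prLink]
    rw [this]; exact p.continuous_prL

theorem prLink_nonneg (b : Bool) (r : ℝ) : 0 ≤ p.prLink b r := by
  cases b
  · simpa [prLink] using p.prL_le_one r
  · simpa [prLink] using p.prL_nonneg r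

theorem prLink_true_add_prLink_false (r : ℝ) : p.prLink true r + p.prLink false r = 1 := by
  simp [prLink]

theorem ofReal_prLink_add (r : ℝ) :
    ENNReal.ofReal (p.prLink true r) + ENNReal.ofReal (p.prLink false r) = 1 := by
  rw [← ENNReal.ofReal_add (p.prLink_nonneg _ _) (p.prLink_nonneg _ _),
    prLink_true_add_prLink_false, ENNReal.ofReal_one]

end NetParams

/-- Polar coordinates: the weight `2 * π * u` is the dimension 2 times the area `π` of the unit disc
times `u`. -/
theorem lintegral_ball_fun_norm {f : ℝ → ℝ} (hf : Continuous f) (h0 : ∀ r, 0 ≤ f r) {t : ℝ}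
    (ht : 0 ≤ t) :
    ∫⁻ x in Metric.ball (0 : Plane) t, ENNReal.ofReal (f ‖x‖) =
      ENNReal.ofReal (∫ u in (0 : ℝ)..t, f u * (2 * Real.pi * u)) := by
  have hint : IntegrableOn (fun x : Plane => f ‖x‖) (Metric.ball 0 t) :=
    ((hf.comp continuous_norm).continuousOn.integrableOn_compact
      (isCompact_closedBall (0 : Plane) t)).mono_set Metric.ball_subset_closedBall
  rw [← ofReal_integral_eq_lintegral_ofReal hint (Filter.Eventually.of_forall fun x => h0 _)]
  congr 1
  have h1 : ∫ x in Metric.ball (0 : Plane) t, f ‖x‖ =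
      ∫ x : Plane, (Iio t).indicator f ‖x‖ := by
    rw [← integral_indicator measurableSet_ball]
    refine integral_congr_ae (Filter.Eventually.of_forall fun x => ?_)
    simp [indicator]
  have hb : (volume : Measure Plane).real (Metric.ball 0 1) = Real.pi := by
    rw [Measure.real, EuclideanSpace.volume_ball_fin_two]
    simp [ENNReal.toReal_ofReal Real.pi_pos.le]
  rw [h1, integral_fun_norm_addHaar, hb, intervalIntegral.integral_of_le ht,
    integral_Ioc_eq_integral_Ioo, finrank_euclideanSpace_fin]
  have h2 : ∫ y in Ioi (0 : ℝ), y ^ (2 - 1) • (Iio t).indicator f y =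
      ∫ y in Ioo (0 : ℝ) t, y * f y := by
    rw [← Ioi_inter_Iio, ← setIntegral_indicator measurableSet_Iio]
    refine integral_congr_ae (Filter.Eventually.of_forall fun y => ?_)
    by_cases hy : y < t <;> simp [indicator, hy]
  rw [h2]
  simp only [nsmul_eq_mul, smul_eq_mul, ← integral_const_mul]
  refine integral_congr_ae (Filter.Eventually.of_forall fun x => ?_)
  push_cast; ring

/-! ### Avoidance probabilities of the marked points -/

section

variable {Ω : Type*} [MeasurableSpace Ω] {P : Measure Ω} {p : NetParams} {N : Network Ω}

theorem IsDownlinkNetwork.measurable_pos (hN : IsDownlinkNetwork P p N) (i : ℕ) :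
    Measurable (N.pos i) := hN.hppp.measurable i

theorem IsDownlinkNetwork.measurableSet_avoid (hN : IsDownlinkNetwork P p N)
    {K : Bool → Set Plane} (hK : ∀ b, MeasurableSet (K b)) (i : ℕ) :
    MeasurableSet {ω | N.pos i ω ∉ K (N.los i ω)} := by
  have : {ω | N.pos i ω ∉ K (N.los i ω)} =
      ⋃ b : Bool, (N.los i ⁻¹' {b} ∩ (N.pos i ⁻¹' K b)ᶜ) := by
    ext ω; simp
  rw [this]
  exact MeasurableSet.iUnion fun b => (hN.measurable_los i (measurableSet_singleton b)).inter
    (hN.measurable_pos i (hK b)).compl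

/-- The probability that the marked points with indices below `n` avoid the sets `K b`. -/
theorem IsDownlinkNetwork.measure_avoid_range (hN : IsDownlinkNetwork P p N)
    {K : Bool → Set Plane} (hK : ∀ b, MeasurableSet (K b)) (n : ℕ) :
    P {ω | ∀ i ∈ Finset.range n, N.pos i ω ∉ K (N.los i ω)} =
      ∫⁻ ω, ∏ i ∈ Finset.range n,
        ((K true)ᶜ.indicator (fun x => ENNReal.ofReal (p.prLink true ‖x‖)) (N.pos i ω) +
          (K false)ᶜ.indicator (fun x => ENNReal.ofReal (p.prLink false ‖x‖)) (N.pos i ω)) ∂P := by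
  set F : Bool → Plane → ℝ≥0∞ :=
    fun b => (K b)ᶜ.indicator (fun x => ENNReal.ofReal (p.prLink b ‖x‖)) with hF
  have hFm : ∀ b, Measurable (F b) := fun b =>
    ((p.continuous_prLink b).measurable.comp measurable_norm).ennreal_ofReal.indicator (hK b).compl
  -- `T` is a candidate for the set of LoS indices below `n`. Once it is fixed, avoidance constrains
  -- the positions alone, as `law_los` requires.
  let A : Finset ℕ → Set (ℕ → Plane) := fun T =>
    {x | ∀ i ∈ Finset.range n, x i ∉ K (decide (i ∈ T))}
  have hA : ∀ T, MeasurableSet (A T) := fun T => by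
    have : A T = ⋂ i ∈ Finset.range n, (fun x : ℕ → Plane => x i) ⁻¹' (K (decide (i ∈ T)))ᶜ := by
      ext; simp [A]
    rw [this]
    exact Finset.measurableSet_biInter _ fun i _ => measurable_pi_apply i (hK _).compl
  let E : Finset ℕ → Set Ω := fun T => {ω | (fun i => N.pos i ω) ∈ A T ∧
    ∀ i ∈ Finset.range n, N.los i ω = decide (i ∈ T)}
  have hpos : Measurable fun ω i => N.pos i ω := measurable_pi_lambda _ hN.measurable_pos
  have hE : ∀ T, MeasurableSet (E T) := fun T => by
    have : E T = (fun ω i => N.pos i ω) ⁻¹' A T ∩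
        ⋂ i ∈ Finset.range n, N.los i ⁻¹' {decide (i ∈ T)} := by
      ext; simp [E]
    rw [this]
    exact (hpos (hA T)).inter
      (Finset.measurableSet_biInter _ fun i _ => hN.measurable_los i (measurableSet_singleton _))
  have hunion : {ω | ∀ i ∈ Finset.range n, N.pos i ω ∉ K (N.los i ω)} =
      ⋃ T ∈ (Finset.range n).powerset, E T := by
    ext ω
    simp only [mem_ofPred_eq, mem_iUnion, E, A]
    constructor
    · intro h
      refine ⟨(Finset.range n).filter (fun i => N.los i ω = true),
        Finset.mem_powerset.2 (Finset.filter_subset _ _), ?_⟩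
      have hl : ∀ i ∈ Finset.range n, N.los i ω =
          decide (i ∈ (Finset.range n).filter (fun i => N.los i ω = true)) := by
        intro i hi
        rw [Finset.mem_range] at hi
        simp [hi]
      exact ⟨fun i hi => hl i hi ▸ h i hi, hl⟩
    · rintro ⟨T, -, h1, h2⟩ i hi
      rw [h2 i hi]; exact h1 i hi
  have hdisj : (↑(Finset.range n).powerset : Set (Finset ℕ)).PairwiseDisjoint E := by
    intro S hS T hT hST
    refine disjoint_left.2 fun ω h1 h2 => hST ?_
    simp only [Finset.coe_powerset, mem_preimage, mem_powerset_iff, Finset.coe_subset] at hS hT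
    ext i
    by_cases hi : i ∈ Finset.range n
    · have := (h1.2 i hi).symm.trans (h2.2 i hi)
      simpa using this
    · exact ⟨fun h => absurd (hS h) hi, fun h => absurd (hT h) hi⟩
  rw [hunion, measure_biUnion_finset hdisj fun T _ => hE T]
  have hprod : ∀ T : Finset ℕ, Measurable fun ω => (∏ i ∈ T, F true (N.pos i ω)) *
      ∏ i ∈ Finset.range n \ T, F false (N.pos i ω) := fun T =>
    (Finset.measurable_fun_prod _ fun i _ => (hFm true).comp (hN.measurable_pos i)).mul
      (Finset.measurable_fun_prod _ fun i _ => (hFm false).comp (hN.measurable_pos i))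
  change _ = ∫⁻ ω, ∏ i ∈ Finset.range n, (F true (N.pos i ω) + F false (N.pos i ω)) ∂P
  -- Expanding the product of sums gives one term per index set `T`, matching the partition of the
  -- event by its LoS indices.
  simp_rw [Finset.prod_add]
  rw [lintegral_finsetSum _ fun T _ => hprod T]
  refine Finset.sum_congr rfl fun T hT => ?_
  rw [hN.law_los (A T) (hA T) (Finset.range n) fun i => decide (i ∈ T),
    ← lintegral_indicator (s := {ω | (fun i => N.pos i ω) ∈ A T}) (hpos (hA T))]
  refine lintegral_congr fun ω => ?_
  have hsplit : (∏ i ∈ T, F true (N.pos i ω)) * ∏ i ∈ Finset.range n \ T, F false (N.pos i ω) =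
      ∏ i ∈ Finset.range n, F (decide (i ∈ T)) (N.pos i ω) := by
    rw [← Finset.prod_sdiff (Finset.mem_powerset.1 hT), mul_comm]
    congr 1
    · exact Finset.prod_congr rfl fun i hi => by simp [(Finset.mem_sdiff.1 hi).2]
    · exact Finset.prod_congr rfl fun i hi => by simp [hi]
  rw [hsplit]
  by_cases hω : (fun i => N.pos i ω) ∈ A T
  · rw [indicator_of_mem (show ω ∈ {ω | (fun i => N.pos i ω) ∈ A T} from hω)]
    refine Finset.prod_congr rfl fun i hi => ?_
    rw [hF]
    simp only
    rw [indicator_of_mem (hω i hi), NetParams.prLink]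
  · rw [indicator_of_notMem (show ω ∉ {ω | (fun i => N.pos i ω) ∈ A T} from hω)]
    have : ∃ i ∈ Finset.range n, N.pos i ω ∈ K (decide (i ∈ T)) := by
      by_contra! hcon
      exact hω hcon
    obtain ⟨i, hi, hiK⟩ := this
    refine (Finset.prod_eq_zero hi ?_).symm
    rw [hF]
    simp only
    rw [indicator_of_notMem (not_not.2 hiK)]

variable [IsProbabilityMeasure P]

/-- Given its position `x`, a point violates its constraint with probability `g x`, the sum over the
types `b` with `x ∈ K b` of the probability of type `b`. The events for the first `n` points
decrease to the full event, so its probability is the generating functional at `g`. -/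
theorem IsDownlinkNetwork.measure_avoid (hN : IsDownlinkNetwork P p N)
    {K : Bool → Set Plane} (hK : ∀ b, MeasurableSet (K b)) (hv : ∀ b, volume (K b) ≠ ∞) :
    P {ω | ∀ i, N.pos i ω ∉ K (N.los i ω)} =
      ENNReal.ofReal (Real.exp (-(p.lamB *
        ((∫⁻ x in K true, ENNReal.ofReal (p.prLink true ‖x‖)) +
          ∫⁻ x in K false, ENNReal.ofReal (p.prLink false ‖x‖)).toReal))) := by
  have hm : ∀ b, Measurable fun x : Plane => ENNReal.ofReal (p.prLink b ‖x‖) := fun b =>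
    ((p.continuous_prLink b).measurable.comp measurable_norm).ennreal_ofReal
  set G : Bool → Plane → ℝ≥0∞ :=
    fun b => (K b).indicator (fun x => ENNReal.ofReal (p.prLink b ‖x‖)) with hG
  have hGm : ∀ b, Measurable (G b) := fun b => (hm b).indicator (hK b)
  have hGle : ∀ b x, G b x ≤ ENNReal.ofReal (p.prLink b ‖x‖) := fun b x =>
    indicator_le_self' (fun _ _ => zero_le) x
  have hadd : ∀ b x, (K b)ᶜ.indicator (fun x => ENNReal.ofReal (p.prLink b ‖x‖)) x + G b x =
      ENNReal.ofReal (p.prLink b ‖x‖) := fun b x =>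
    indicator_compl_add_self_apply _ _ _
  set g : Plane → ℝ≥0∞ := fun x => G true x + G false x with hg
  have hg1 : ∀ x, g x ≤ 1 := fun x =>
    (add_le_add (hGle _ _) (hGle _ _)).trans_eq (p.ofReal_prLink_add _)
  have hsub : ∀ x, (K true)ᶜ.indicator (fun x => ENNReal.ofReal (p.prLink true ‖x‖)) x +
      (K false)ᶜ.indicator (fun x => ENNReal.ofReal (p.prLink false ‖x‖)) x = 1 - g x := by
    intro x
    refine ENNReal.eq_sub_of_add_eq (ne_top_of_le_ne_top ENNReal.one_ne_top (hg1 x)) ?_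
    rw [hg]
    simp only
    rw [add_add_add_comm, hadd, hadd, p.ofReal_prLink_add]
  have hgint : ∫⁻ x, g x = (∫⁻ x in K true, ENNReal.ofReal (p.prLink true ‖x‖)) +
      ∫⁻ x in K false, ENNReal.ofReal (p.prLink false ‖x‖) := by
    rw [hg, lintegral_add_left (hGm true), lintegral_indicator (hK _), lintegral_indicator (hK _)]
  have hfin : ∀ b, ∫⁻ x in K b, ENNReal.ofReal (p.prLink b ‖x‖) ≠ ∞ := fun b => by
    refine ne_top_of_le_ne_top (hv b) ?_
    rw [← setLIntegral_one]
    refine lintegral_mono fun x => ?_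
    rw [← p.ofReal_prLink_add ‖x‖]
    cases b
    · exact le_add_self
    · exact le_self_add
  have hgm : Measurable g := (hGm true).add (hGm false)
  rw [← hgint, ← hN.hppp.lintegral_retentionProd p.lamB_pos.le hgm hg1
    (by rw [hgint]; exact ENNReal.add_ne_top.2 ⟨hfin _, hfin _⟩)]
  have hset : {ω | ∀ i, N.pos i ω ∉ K (N.los i ω)} =
      ⋂ n, {ω | ∀ i ∈ Finset.range n, N.pos i ω ∉ K (N.los i ω)} := by
    ext ω
    simp only [mem_ofPred_eq, mem_iInter]
    exact ⟨fun h n i _ => h i, fun h i => h (i + 1) i (by simp)⟩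
  have hanti : Antitone fun n => {ω | ∀ i ∈ Finset.range n, N.pos i ω ∉ K (N.los i ω)} :=
    fun m n hmn ω h i hi => h i (Finset.range_mono hmn hi)
  have hmeas : ∀ n, MeasurableSet {ω | ∀ i ∈ Finset.range n, N.pos i ω ∉ K (N.los i ω)} := by
    intro n
    have : {ω | ∀ i ∈ Finset.range n, N.pos i ω ∉ K (N.los i ω)} =
        ⋂ i ∈ Finset.range n, {ω | N.pos i ω ∉ K (N.los i ω)} := by ext; simp
    rw [this]
    exact Finset.measurableSet_biInter _ fun i _ => hN.measurableSet_avoid hK i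
  rw [hset, hanti.measure_iInter (fun n => (hmeas n).nullMeasurableSet)
    ⟨0, measure_ne_top _ _⟩]
  unfold retentionProd
  rw [lintegral_iInf]
  · refine iInf_congr fun n => ?_
    rw [hN.measure_avoid_range hK]
    simp_rw [hsub]
  · exact fun n => Finset.measurable_fun_prod _ fun i _ =>
      measurable_const.sub (hgm.comp (hN.measurable_pos i))
  · exact fun a b hab ω => antitone_prod_one_sub (fun i => g (N.pos i ω)) hab
  · simp

/-- The nearest LoS and NLoS distances have independent tails. -/
theorem IsDownlinkNetwork.measure_le_norm (hN : IsDownlinkNetwork P p N) {t : Bool → ℝ}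
    (ht : ∀ b, 0 ≤ t b) :
    P {ω | ∀ i, t (N.los i ω) ≤ ‖N.pos i ω‖} =
      ENNReal.ofReal (p.voidLink true (t true)) * ENNReal.ofReal (p.voidLink false (t false)) := by
  have := hN.measure_avoid (K := fun b => Metric.ball 0 (t b)) (fun _ => measurableSet_ball)
    (fun b => measure_ball_lt_top.ne)
  simp only [mem_ball_zero_iff, not_lt] at this
  have h0 : ∀ b, 0 ≤ ∫ u in (0 : ℝ)..t b, p.prLink b u * (2 * Real.pi * u) := fun b =>
    intervalIntegral.integral_nonneg (ht b) fun u hu =>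
      mul_nonneg (p.prLink_nonneg _ _) (mul_nonneg (by positivity) hu.1)
  have hv : ∀ b, p.voidLink b (t b) =
      Real.exp (-(p.lamB * ∫ u in (0 : ℝ)..t b, p.prLink b u * (2 * Real.pi * u))) := fun b => by
    rw [NetParams.voidLink, ← intervalIntegral.integral_const_mul]
    congr 2
    refine intervalIntegral.integral_congr fun u _ => ?_
    ring
  rw [this, lintegral_ball_fun_norm (p.continuous_prLink _) (p.prLink_nonneg _) (ht _),
    lintegral_ball_fun_norm (p.continuous_prLink _) (p.prLink_nonneg _) (ht _),
    ← ENNReal.ofReal_add (h0 _) (h0 _), ENNReal.toReal_ofReal (add_nonneg (h0 _) (h0 _)),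
    hv, hv, ← ENNReal.ofReal_mul (Real.exp_pos _).le, ← Real.exp_add]
  congr 2
  ring

end

/-! ### Law and independence of the nearest LoS and NLoS distances -/

namespace NetParams

variable (p : NetParams)

/-- The density of the distance of the nearest BS with a link of type `b`. -/
def nearestDensity (b : Bool) (r : ℝ) : ℝ :=
  p.voidLink b r * (p.prLink b r * (2 * Real.pi * r * p.lamB))

/-- The void probability is the tail of the nearest distance, so this identifies `nearestDensity` as
the density of that distance. -/
theorem hasDerivAt_voidLink (b : Bool) (t : ℝ) :
    HasDerivAt (p.voidLink b) (-p.nearestDensity b t) t := by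
  have hc : Continuous fun u => p.prLink b u * (2 * Real.pi * u * p.lamB) :=
    (p.continuous_prLink b).mul (by fun_prop)
  have h := ((hc.integral_hasStrictDerivAt 0 t).hasDerivAt.fun_neg).exp
  rw [mul_neg] at h
  exact h

theorem continuous_voidLink (b : Bool) : Continuous (p.voidLink b) :=
  continuous_iff_continuousAt.2 fun t => (p.hasDerivAt_voidLink b t).continuousAt

theorem continuous_nearestDensity (b : Bool) : Continuous (p.nearestDensity b) :=
  (p.continuous_voidLink b).mul ((p.continuous_prLink b).mul (by fun_prop))

theorem voidLink_pos (b : Bool) (t : ℝ) : 0 < p.voidLink b t := Real.exp_pos _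

theorem nearestDensity_nonneg (b : Bool) {r : ℝ} (hr : 0 ≤ r) : 0 ≤ p.nearestDensity b r :=
  mul_nonneg (p.voidLink_pos b r).le (mul_nonneg (p.prLink_nonneg b r)
    (mul_nonneg (mul_nonneg (by positivity) hr) p.lamB_pos.le))

theorem voidLink_zero (b : Bool) : p.voidLink b 0 = 1 := by simp [voidLink]

theorem lintegral_nearestDensity (b : Bool) {s t : ℝ} (hs : 0 ≤ s) (hst : s ≤ t) :
    ∫⁻ r in Ico s t, ENNReal.ofReal (p.nearestDensity b r) =
      ENNReal.ofReal (p.voidLink b s) - ENNReal.ofReal (p.voidLink b t) := by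
  have hint : IntegrableOn (p.nearestDensity b) (Ico s t) :=
    ((p.continuous_nearestDensity b).continuousOn.integrableOn_compact isCompact_Icc).mono_set
      Ico_subset_Icc_self
  rw [← ofReal_integral_eq_lintegral_ofReal hint
    ((ae_restrict_iff' measurableSet_Ico).2 (Filter.Eventually.of_forall fun r hr =>
      p.nearestDensity_nonneg b (hs.trans hr.1))), integral_Ico_eq_integral_Ioc,
    ← intervalIntegral.integral_of_le hst, ← ENNReal.ofReal_sub _ (p.voidLink_pos b t).le]
  congr 1
  have := intervalIntegral.integral_eq_sub_of_hasDerivAt (a := s) (b := t)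
    (f := fun r => -p.voidLink b r) (f' := p.nearestDensity b)
    (fun r _ => by simpa using (p.hasDerivAt_voidLink b r).fun_neg)
    ((p.continuous_nearestDensity b).intervalIntegrable _ _)
  rw [this]; ring

end NetParams

namespace Network

variable {Ω : Type*} (N : Network Ω)

/-- The distance of the nearest BS with a link of type `b`, infinite if there is none. -/
def nearest (b : Bool) (ω : Ω) : ℝ≥0∞ :=
  ⨅ i, if N.los i ω = b then ENNReal.ofReal ‖N.pos i ω‖ else ∞

variable {N}

theorem ofReal_le_nearest {b : Bool} {ω : Ω} {t : ℝ} :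
    ENNReal.ofReal t ≤ N.nearest b ω ↔ ∀ i, N.los i ω = b → t ≤ ‖N.pos i ω‖ := by
  rw [nearest, le_iInf_iff]
  refine forall_congr' fun i => ?_
  split_ifs with h
  · rw [ENNReal.ofReal_le_ofReal_iff (norm_nonneg _)]; simp [h]
  · simp [h]

theorem nearest_le {b : Bool} {ω : Ω} {i : ℕ} (h : N.los i ω = b) :
    N.nearest b ω ≤ ENNReal.ofReal ‖N.pos i ω‖ :=
  (iInf_le _ i).trans_eq (if_pos h)

end Network

/-- Makes tails at finite thresholds sufficient to test independence of `[0, ∞]`-valued distances: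
the point `∞` is recovered as an intersection of such tails. -/
theorem ENNReal.borel_eq_generateFrom_Ici_ofReal :
    borel ℝ≥0∞ = MeasurableSpace.generateFrom {S | ∃ t : ℝ, 0 ≤ t ∧ S = Ici (ENNReal.ofReal t)} := by
  apply le_antisymm
  · rw [borel_eq_generateFrom_Ici]
    refine MeasurableSpace.generateFrom_le ?_
    rintro _ ⟨a, rfl⟩
    by_cases ha : a = ∞
    · have : Ici a = ⋂ n : ℕ, Ici (ENNReal.ofReal n) := by
        ext x
        simp only [ha, mem_Ici, top_le_iff, mem_iInter, ENNReal.ofReal_natCast]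
        refine ⟨fun h n => h ▸ le_top, fun h => ENNReal.eq_top_of_forall_nnreal_le fun r => ?_⟩
        obtain ⟨n, hn⟩ := exists_nat_ge r
        exact le_trans (by exact_mod_cast hn) (h n)
      rw [this]
      exact MeasurableSet.iInter fun n =>
        MeasurableSpace.measurableSet_generateFrom ⟨n, n.cast_nonneg, rfl⟩
    · exact MeasurableSpace.measurableSet_generateFrom
        ⟨a.toReal, ENNReal.toReal_nonneg, by rw [ENNReal.ofReal_toReal ha]⟩
  · refine MeasurableSpace.generateFrom_le ?_
    rintro _ ⟨t, -, rfl⟩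
    rw [← BorelSpace.measurable_eq (α := ℝ≥0∞)]
    exact measurableSet_Ici

section

variable {Ω : Type*} [MeasurableSpace Ω] {P : Measure Ω} {p : NetParams} {N : Network Ω}

theorem IsDownlinkNetwork.measurable_nearest (hN : IsDownlinkNetwork P p N) (b : Bool) :
    Measurable (N.nearest b) :=
  Measurable.iInf fun i => Measurable.ite (hN.measurable_los i (measurableSet_singleton b))
    (hN.measurable_pos i).norm.ennreal_ofReal measurable_const

variable [IsProbabilityMeasure P]

theorem IsDownlinkNetwork.measure_le_nearest_inter (hN : IsDownlinkNetwork P p N) (b : Bool)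
    {s t : ℝ} (hs : 0 ≤ s) (ht : 0 ≤ t) :
    P (N.nearest b ⁻¹' Ici (ENNReal.ofReal s) ∩ N.nearest (!b) ⁻¹' Ici (ENNReal.ofReal t)) =
      ENNReal.ofReal (p.voidLink b s) * ENNReal.ofReal (p.voidLink (!b) t) := by
  have hset : N.nearest b ⁻¹' Ici (ENNReal.ofReal s) ∩ N.nearest (!b) ⁻¹' Ici (ENNReal.ofReal t) =
      {ω | ∀ i, (fun c => if c = b then s else t) (N.los i ω) ≤ ‖N.pos i ω‖} := by
    ext ω
    simp only [mem_inter_iff, mem_preimage, mem_Ici, Network.ofReal_le_nearest, mem_ofPred_eq]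
    rw [← forall_and]
    refine forall_congr' fun i => ?_
    by_cases h : N.los i ω = b
    · simp [h]
    · have h' : N.los i ω = !b := Bool.eq_not_of_ne h
      simp [h']
  rw [hset, hN.measure_le_norm (t := fun c => if c = b then s else t)
    (fun c => by split_ifs <;> assumption)]
  cases b
  · simp [mul_comm]
  · simp

theorem IsDownlinkNetwork.measure_le_nearest (hN : IsDownlinkNetwork P p N) (b : Bool)
    {s : ℝ} (hs : 0 ≤ s) :
    P (N.nearest b ⁻¹' Ici (ENNReal.ofReal s)) = ENNReal.ofReal (p.voidLink b s) := by
  have := hN.measure_le_nearest_inter b hs le_rfl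
  simpa [p.voidLink_zero] using this

/-- Tails at finite thresholds form a generating π-system, and on them the joint probability is a
product of void probabilities. -/
theorem IsDownlinkNetwork.indepFun_nearest (hN : IsDownlinkNetwork P p N) (b : Bool) :
    IndepFun (N.nearest b) (N.nearest (!b)) P := by
  set C : Set (Set ℝ≥0∞) := {S | ∃ t : ℝ, 0 ≤ t ∧ S = Ici (ENNReal.ofReal t)}
  have hC : IsPiSystem C := by
    rintro _ ⟨s, hs, rfl⟩ _ ⟨t, ht, rfl⟩ -
    refine ⟨max s t, le_max_of_le_left hs, ?_⟩
    rw [Ici_inter_Ici, ENNReal.ofReal_max]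
  have hgen : ∀ c, MeasurableSpace.comap (N.nearest c) inferInstance =
      MeasurableSpace.generateFrom {S | ∃ t ∈ C, N.nearest c ⁻¹' t = S} := fun c => by
    rw [BorelSpace.measurable_eq (α := ℝ≥0∞), ENNReal.borel_eq_generateFrom_Ici_ofReal,
      MeasurableSpace.comap_generateFrom]
    rfl
  rw [IndepFun_iff_Indep]
  refine IndepSets.indep (hN.measurable_nearest b).comap_le (hN.measurable_nearest (!b)).comap_le
    (hC.comap _) (hC.comap _) (hgen _) (hgen _) ?_
  rw [IndepSets_iff]
  rintro _ _ ⟨_, ⟨s, hs, rfl⟩, rfl⟩ ⟨_, ⟨t, ht, rfl⟩, rfl⟩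
  rw [hN.measure_le_nearest_inter b hs ht, hN.measure_le_nearest b hs,
    hN.measure_le_nearest (!b) ht]

/-- The law of the distance of the nearest BS with a link of type `b`, where there is one. -/
theorem IsDownlinkNetwork.map_nearest (hN : IsDownlinkNetwork P p N) (b : Bool) :
    (P.restrict {ω | N.nearest b ω ≠ ∞}).map (fun ω => (N.nearest b ω).toReal) =
      (volume.restrict (Ici 0)).withDensity fun r => ENNReal.ofReal (p.nearestDensity b r) := by
  have hm := hN.measurable_nearest b
  have hmr : Measurable fun ω => (N.nearest b ω).toReal := hm.ennreal_toReal
  refine Measure.ext_of_Ico _ _ fun s t hst => ?_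
  rw [Measure.map_apply hmr measurableSet_Ico, Measure.restrict_apply (hmr measurableSet_Ico),
    withDensity_apply _ measurableSet_Ico, Measure.restrict_restrict measurableSet_Ico]
  have hR : Ico s t ∩ Ici 0 = Ico (max s 0) t := by
    rw [← Ici_inter_Iio, inter_right_comm, Ici_inter_Ici, Ici_inter_Iio]
  rw [hR]
  rcases le_or_gt t 0 with ht | ht
  · rw [Ico_eq_empty (fun h => not_lt.2 ht (lt_of_le_of_lt (le_max_right s 0) h))]
    have : (fun ω => (N.nearest b ω).toReal) ⁻¹' Ico s t = ∅ := by
      ext ω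
      simp only [mem_preimage, mem_Ico, mem_empty_iff_false, iff_false, not_and, not_lt]
      exact fun _ => ht.trans ENNReal.toReal_nonneg
    simp [this]
  · have hs0 : 0 ≤ max s 0 := le_max_right _ _
    have hle : max s 0 ≤ t := max_le hst.le ht.le
    -- The mass of an interval is a difference of two tails. The restriction to finite distances
    -- matters because `toReal` sends `∞` to 0.
    have hset : (fun ω => (N.nearest b ω).toReal) ⁻¹' Ico s t ∩ {ω | N.nearest b ω ≠ ∞} =
        N.nearest b ⁻¹' Ici (ENNReal.ofReal (max s 0)) \
          N.nearest b ⁻¹' Ici (ENNReal.ofReal t) := by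
      ext ω
      simp only [mem_inter_iff, mem_preimage, mem_Ico, mem_ofPred_eq, mem_sdiff, mem_Ici, not_le]
      constructor
      · rintro ⟨⟨h1, h2⟩, h3⟩
        refine ⟨(ENNReal.ofReal_le_iff_le_toReal h3).2 (max_le h1 ENNReal.toReal_nonneg),
          (ENNReal.lt_ofReal_iff_toReal_lt h3).2 h2⟩
      · rintro ⟨h1, h2⟩
        have h3 : N.nearest b ω ≠ ∞ := ne_top_of_lt h2
        exact ⟨⟨(le_max_left _ _).trans ((ENNReal.ofReal_le_iff_le_toReal h3).1 h1),
          (ENNReal.lt_ofReal_iff_toReal_lt h3).1 h2⟩, h3⟩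
    rw [hset, measure_sdiff (preimage_mono (Ici_subset_Ici.2 (ENNReal.ofReal_le_ofReal hle)))
      (hm measurableSet_Ici).nullMeasurableSet (measure_ne_top _ _),
      hN.measure_le_nearest b hs0, hN.measure_le_nearest b ht.le,
      p.lintegral_nearestDensity b hs0 hle]

theorem IsDownlinkNetwork.measure_nearest_eq_ofReal (hN : IsDownlinkNetwork P p N) (b : Bool)
    {t : ℝ} (ht : 0 ≤ t) : P {ω | N.nearest b ω = ENNReal.ofReal t} = 0 := by
  have h0 : (P.restrict {ω | N.nearest b ω ≠ ∞}).map (fun ω => (N.nearest b ω).toReal) {t} = 0 := by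
    rw [hN.map_nearest b]
    exact withDensity_absolutelyContinuous _ _
      (Measure.absolutelyContinuous_of_le Measure.restrict_le_self (by simp))
  have hmr : Measurable fun ω => (N.nearest b ω).toReal := (hN.measurable_nearest b).ennreal_toReal
  rw [Measure.map_apply hmr (measurableSet_singleton t),
    Measure.restrict_apply (hmr (measurableSet_singleton t))] at h0
  refine measure_mono_null (fun ω hω => ?_) h0
  have hω' : N.nearest b ω = ENNReal.ofReal t := hω
  simp [hω', ENNReal.toReal_ofReal ht]

end

/-! ### Comparison of path losses -/

/-- Both sides are compared through the squared 3D distance `u ^ 2 + L ^ 2`, raised to the power `α'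
/ 2`. When the expression under the outer root is negative, `Real.sqrt` returns 0 and both sides
hold, in agreement with the convention for `r1` and `r2`. -/
theorem mul_sqrt_rpow_neg_le_iff {A A' α α' L r u : ℝ} (hA : 0 < A) (hA' : 0 < A')
    (hα' : 0 < α') (hr : 0 < r ^ 2 + L ^ 2) (hV : 0 < u ^ 2 + L ^ 2) (hu : 0 ≤ u) :
    A' * Real.sqrt (u ^ 2 + L ^ 2) ^ (-α') ≤ A * Real.sqrt (r ^ 2 + L ^ 2) ^ (-α) ↔
      Real.sqrt ((A / A') ^ (-(2 / α')) * (r ^ 2 + L ^ 2) ^ (α / α') - L ^ 2) ≤ u := by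
  have e : ∀ x : ℝ, 0 < x → ∀ β : ℝ, Real.sqrt x ^ (-β) = (x ^ (β / 2))⁻¹ := fun x hx β => by
    rw [Real.sqrt_eq_rpow, ← Real.rpow_mul hx.le, ← Real.rpow_neg hx.le]
    congr 1; ring
  rw [Real.sqrt_le_left hu, sub_le_iff_le_add, e _ hV, e _ hr]
  set V := u ^ 2 + L ^ 2
  set W := r ^ 2 + L ^ 2
  have hX : 0 ≤ (A / A') ^ (-(2 / α')) * W ^ (α / α') := by positivity
  rw [← Real.rpow_le_rpow_iff hX hV.le (half_pos hα'),
    Real.mul_rpow (by positivity) (by positivity), ← Real.rpow_mul (by positivity),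
    ← Real.rpow_mul hr.le]
  have e1 : -(2 / α') * (α' / 2) = -1 := by field_simp
  have e2 : α / α' * (α' / 2) = α / 2 := by field_simp
  rw [e1, e2, Real.rpow_neg_one, ← div_eq_mul_inv, ← div_eq_mul_inv,
    div_le_div_iff₀ (by positivity) (by positivity), inv_div, div_mul_eq_mul_div,
    div_le_iff₀ hA, mul_comm A]

namespace NetParams

variable (p : NetParams)

/-- A BS whose link is not of type `b` is weaker than one at distance `r` with a link of type `b`
iff it is farther than `crossDist b r`. -/
def crossDist (b : Bool) (r : ℝ) : ℝ := if b then p.r1 r else p.r2 r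

theorem crossDist_nonneg (b : Bool) (r : ℝ) : 0 ≤ p.crossDist b r := by
  cases b <;> exact Real.sqrt_nonneg _

theorem measurable_crossDist (b : Bool) : Measurable (p.crossDist b) := by
  cases b
  · change Measurable p.r2
    unfold r2; fun_prop
  · change Measurable p.r1
    unfold r1; fun_prop

theorem zeta_true : p.zeta true = fun r => p.AL * p.dist3 r ^ (-p.alphaL) := by
  ext; simp [zeta]

theorem zeta_false : p.zeta false = fun r => p.ANL * p.dist3 r ^ (-p.alphaNL) := by
  ext; simp [zeta]

theorem measurable_zeta (b : Bool) : Measurable (p.zeta b) := by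
  have := p.continuous_dist3.measurable
  cases b
  · rw [zeta_false]; fun_prop
  · rw [zeta_true]; fun_prop

theorem zeta_pos (b : Bool) {r : ℝ} (hr : 0 < r) : 0 < p.zeta b r := by
  have h : 0 < p.dist3 r := Real.sqrt_pos.2 (by positivity)
  cases b
  · exact mul_pos p.ANL_pos (Real.rpow_pos_of_pos h _)
  · exact mul_pos p.AL_pos (Real.rpow_pos_of_pos h _)

theorem zeta_not_le_zeta_iff (b : Bool) {r u : ℝ} (hr : 0 < r) (hu : 0 < u) :
    p.zeta (!b) u ≤ p.zeta b r ↔ p.crossDist b r ≤ u := by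
  cases b
  · exact mul_sqrt_rpow_neg_le_iff p.ANL_pos p.AL_pos p.alphaL_pos (by positivity) (by positivity)
      hu.le
  · exact mul_sqrt_rpow_neg_le_iff p.AL_pos p.ANL_pos p.alphaNL_pos (by positivity) (by positivity)
      hu.le

/-- With equal constants and exponents on both links, the crossover distance is `r` itself. -/
theorem zeta_le_zeta_iff (b : Bool) {r u : ℝ} (hr : 0 < r) (hu : 0 < u) :
    p.zeta b u ≤ p.zeta b r ↔ r ≤ u := by
  have key : ∀ A α : ℝ, 0 < A → 0 < α →
      (A * p.dist3 u ^ (-α) ≤ A * p.dist3 r ^ (-α) ↔ r ≤ u) := fun A α hA hα => by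
    have := mul_sqrt_rpow_neg_le_iff (α := α) (L := p.L) hA hA hα (show 0 < r ^ 2 + p.L ^ 2 by positivity)
      (show 0 < u ^ 2 + p.L ^ 2 by positivity) hu.le
    rwa [div_self hA.ne', div_self hα.ne', Real.one_rpow, Real.rpow_one, one_mul,
      add_sub_cancel_right, Real.sqrt_sq hr.le] at this
  cases b
  · exact key _ _ p.ANL_pos p.alphaNL_pos
  · exact key _ _ p.AL_pos p.alphaL_pos

/-- Links of different types at distances `r` and `u` are equally strong only if `u` is the
crossover distance. -/
theorem eq_crossDist (b : Bool) {r u : ℝ} (hr : 0 < r) (hu : 0 < u) (h : p.crossDist b r ≤ u)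
    (h' : p.crossDist (!b) u ≤ r) : u = p.crossDist b r := by
  refine le_antisymm ?_ h
  by_contra! hlt
  have h0 := p.crossDist_nonneg b r
  -- A link at `v` of the type of `u` would be nearer than `u` yet no stronger. The midpoint is used
  -- because the crossover distance may be 0, where the comparison lemmas do not apply.
  set v := (p.crossDist b r + u) / 2 with hv
  have hv0 : 0 < v := by rw [hv]; linarith
  have h1 : p.zeta (!b) v ≤ p.zeta b r :=
    (p.zeta_not_le_zeta_iff b hr hv0).2 (by rw [hv]; linarith)
  have h2 : p.zeta b r ≤ p.zeta (!b) u := by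
    have := (p.zeta_not_le_zeta_iff (!b) hu hr).2 h'
    rwa [Bool.not_not] at this
  have := (p.zeta_le_zeta_iff (!b) hu hv0).1 (h1.trans h2)
  rw [hv] at this
  linarith

theorem tendsto_zeta (b : Bool) : Filter.Tendsto (p.zeta b) Filter.atTop (nhds 0) := by
  have hd : Filter.Tendsto p.dist3 Filter.atTop Filter.atTop :=
    Filter.tendsto_atTop_mono (fun r => Real.le_sqrt_of_sq_le (le_add_of_nonneg_right (sq_nonneg p.L)))
      Filter.tendsto_id
  cases b
  · simpa [zeta_false] using ((tendsto_rpow_neg_atTop p.alphaNL_pos).comp hd).const_mul p.ANL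
  · simpa [zeta_true] using ((tendsto_rpow_neg_atTop p.alphaL_pos).comp hd).const_mul p.AL

end NetParams

/-! ### The strongest BS as the winner among the two nearest ones -/

namespace Network

variable {Ω : Type*} {N : Network Ω} {p : NetParams} {ω : Ω}

theorem isStrongest_iff {i : ℕ} :
    N.IsStrongest p i ω ↔ ∀ j, N.linkZeta p j ω ≤ N.linkZeta p i ω :=
  forall_congr' fun _ => mul_le_mul_iff_right₀ p.PB_pos

/-- Path losses tend to 0 at infinity, so outside a large disc every BS is weaker than BS 0, and
only finitely many remain inside. -/
theorem exists_isStrongest (hpos : ∀ i, 0 < N.dist i ω)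
    (hfin : ∀ n : ℕ, {i | N.dist i ω < n}.Finite) : ∃ i, N.IsStrongest p i ω := by
  have hz : 0 < N.linkZeta p 0 ω := p.zeta_pos _ (hpos 0)
  have hev : ∀ᶠ r in Filter.atTop, ∀ b, p.zeta b r < N.linkZeta p 0 ω :=
    Filter.eventually_all.2 fun b => (p.tendsto_zeta b).eventually_lt_const hz
  obtain ⟨M, hM⟩ := Filter.eventually_atTop.1 hev
  obtain ⟨n, hn⟩ := exists_nat_ge M
  have hout : ∀ j, ¬ N.dist j ω < n → N.linkZeta p j ω < N.linkZeta p 0 ω := fun j hj =>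
    hM _ (hn.trans (not_lt.1 hj)) _
  have h0 : N.dist 0 ω < n := by
    by_contra h
    exact lt_irrefl _ (hout 0 h)
  obtain ⟨i, -, hi⟩ := Set.exists_max_image _ (fun j => N.linkZeta p j ω) (hfin n) ⟨0, h0⟩
  refine ⟨i, isStrongest_iff.2 fun j => ?_⟩
  by_cases hj : N.dist j ω < n
  · exact hi j hj
  · exact (hout j hj).le.trans (hi 0 h0)

theorem IsStrongest.nearest_eq {i : ℕ} (h : N.IsStrongest p i ω) (hpos : ∀ i, 0 < N.dist i ω) :
    N.nearest (N.los i ω) ω = ENNReal.ofReal (N.dist i ω) := by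
  refine le_antisymm (nearest_le rfl) (ofReal_le_nearest.2 fun j hj => ?_)
  have := isStrongest_iff.1 h j
  rw [linkZeta, linkZeta, hj] at this
  exact (p.zeta_le_zeta_iff _ (hpos i) (hpos j)).1 this

theorem IsStrongest.crossDist_le {i : ℕ} (h : N.IsStrongest p i ω) (hpos : ∀ i, 0 < N.dist i ω) :
    ENNReal.ofReal (p.crossDist (N.los i ω) (N.dist i ω)) ≤ N.nearest (!N.los i ω) ω := by
  refine ofReal_le_nearest.2 fun j hj => ?_
  have := isStrongest_iff.1 h j
  rw [linkZeta, linkZeta, hj] at this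
  exact (p.zeta_not_le_zeta_iff _ (hpos i) (hpos j)).1 this

theorem isStrongest_serving (h : ∃ i, N.IsStrongest p i ω) :
    N.IsStrongest p (N.serving p ω) ω := Nat.sInf_mem h

/-- The event that the nearest BS with a link of type `b` has a distance in `B` and no BS with the
other link type is stronger. -/
def nearestWins (N : Network Ω) (p : NetParams) (b : Bool) (B : Set ℝ) : Set Ω :=
  {ω | N.nearest b ω ≠ ∞ ∧ (N.nearest b ω).toReal ∈ B ∧
    ENNReal.ofReal (p.crossDist b (N.nearest b ω).toReal) ≤ N.nearest (!b) ω}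

theorem mem_nearestWins_servLoS (hpos : ∀ i, 0 < N.dist i ω) (hex : ∃ i, N.IsStrongest p i ω)
    {B : Set ℝ} (hB : N.servDist p ω ∈ B) : ω ∈ N.nearestWins p (N.servLoS p ω) B := by
  have hs := isStrongest_serving hex
  have h1 := hs.nearest_eq hpos
  have h2 := hs.crossDist_le hpos
  have h3 : (N.nearest (N.servLoS p ω) ω).toReal = N.servDist p ω := by
    rw [servLoS, h1, ENNReal.toReal_ofReal (hpos _).le, servDist]
  refine ⟨?_, h3 ▸ hB, ?_⟩
  · rw [servLoS, h1]; exact ENNReal.ofReal_ne_top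
  · rw [h3]; exact h2

/-- If the nearest BS of type `b` wins while the serving link has the other type, each is at least
as strong as the other. `eq_crossDist` then forces the tie excluded by `htie`. -/
theorem mem_nearestWins_iff (hpos : ∀ i, 0 < N.dist i ω) (hex : ∃ i, N.IsStrongest p i ω)
    {b : Bool} (h0 : N.nearest b ω ≠ 0)
    (htie : N.nearest (!b) ω ≠ ENNReal.ofReal (p.crossDist b (N.nearest b ω).toReal)) {B : Set ℝ} :
    ω ∈ N.nearestWins p b B ↔ N.servDist p ω ∈ B ∧ N.servLoS p ω = b := by
  constructor
  · rintro ⟨h1, h2, h3⟩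
    have hr := ENNReal.toReal_pos h0 h1
    have hs := mem_nearestWins_servLoS hpos hex (mem_univ (N.servDist p ω))
    by_cases hb : N.servLoS p ω = b
    · have := (isStrongest_serving hex).nearest_eq hpos
      change N.nearest (N.servLoS p ω) ω = ENNReal.ofReal (N.servDist p ω) at this
      rw [hb] at this
      have hu : 0 < N.servDist p ω := hpos _
      rw [this, ENNReal.toReal_ofReal hu.le] at h2
      exact ⟨h2, hb⟩
    · have hb' : N.servLoS p ω = !b := Bool.eq_not_of_ne hb
      have hn := (isStrongest_serving hex).nearest_eq hpos
      change N.nearest (N.servLoS p ω) ω = ENNReal.ofReal (N.servDist p ω) at hn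
      rw [hb'] at hs hn
      obtain ⟨h4, -, h5⟩ := hs
      rw [Bool.not_not] at h5
      have hu : 0 < N.servDist p ω := hpos _
      rw [hn, ENNReal.toReal_ofReal hu.le] at h5
      rw [hn, ENNReal.ofReal_le_ofReal_iff hu.le] at h3
      refine absurd ?_ htie
      rw [hn, ← p.eq_crossDist b hr hu h3 ((ENNReal.ofReal_le_iff_le_toReal h1).1 h5)]
  · rintro ⟨h1, rfl⟩
    exact mem_nearestWins_servLoS hpos hex h1

end Network

/-! ### Joint law of the serving distance and type -/

section

variable {Ω : Type*} [MeasurableSpace Ω] {P : Measure Ω} [IsProbabilityMeasure P]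
  {p : NetParams} {N : Network Ω}

/-- The origin has area zero. It must be avoided because for `L = 0` the real power `0 ^ (-α)` is 0
there, which would make the closest BS the weakest. -/
theorem IsDownlinkNetwork.ae_dist_pos (hN : IsDownlinkNetwork P p N) :
    ∀ᵐ ω ∂P, ∀ i, 0 < N.dist i ω := by
  have h := hN.hppp.poisson {0} (measurableSet_singleton _) (by simp) 0
  have h1 : P {ω | pointCount N.pos {0} ω = (0 : ℕ)} = 1 := by
    rw [h, poissonMeasure_singleton]; simp
  have hm : MeasurableSet {ω | pointCount N.pos {0} ω = (0 : ℕ)} :=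
    measurable_pointCount hN.measurable_pos (measurableSet_singleton _) (measurableSet_singleton _)
  rw [← prob_compl_eq_zero_iff hm] at h1
  filter_upwards [measure_eq_zero_iff_ae_notMem.1 h1] with ω hω i
  have h2 : pointCount N.pos {0} ω = 0 := by simpa using hω
  rw [pointCount, encard_eq_zero] at h2
  refine norm_pos_iff.2 fun h3 => ?_
  have : i ∈ {i : ℕ | N.pos i ω ∈ ({0} : Set Plane)} := h3
  rw [h2] at this
  exact this

theorem IsDownlinkNetwork.ae_finite_dist_lt (hN : IsDownlinkNetwork P p N) :
    ∀ᵐ ω ∂P, ∀ n : ℕ, {i | N.dist i ω < n}.Finite := by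
  refine ae_all_iff.2 fun n => ?_
  filter_upwards [hN.hppp.ae_pointCount_ne_top (measurableSet_ball (x := (0 : Plane)) (ε := n))
    measure_ball_lt_top.ne] with ω hω
  simpa [pointCount, Network.dist] using hω

theorem IsDownlinkNetwork.ae_exists_isStrongest (hN : IsDownlinkNetwork P p N) :
    ∀ᵐ ω ∂P, ∃ i, N.IsStrongest p i ω := by
  filter_upwards [hN.ae_dist_pos, hN.ae_finite_dist_lt] with ω h1 h2
  exact Network.exists_isStrongest h1 h2

/-- Fubini for the product law supplied by independence: the first distance is frozen while the
second is averaged. -/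
theorem IsDownlinkNetwork.measure_nearest_pair (hN : IsDownlinkNetwork P p N) (b : Bool)
    {T : Set (ℝ≥0∞ × ℝ≥0∞)} (hT : MeasurableSet T) :
    P {ω | (N.nearest b ω, N.nearest (!b) ω) ∈ T} =
      ∫⁻ ω, P {ω' | (N.nearest b ω, N.nearest (!b) ω') ∈ T} ∂P := by
  have hm := hN.measurable_nearest
  have h := (indepFun_iff_map_prod_eq_prod_map_map (hm b).aemeasurable (hm (!b)).aemeasurable).1
    (hN.indepFun_nearest b)
  have h1 : P {ω | (N.nearest b ω, N.nearest (!b) ω) ∈ T} =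
      P.map (fun ω => (N.nearest b ω, N.nearest (!b) ω)) T :=
    (Measure.map_apply ((hm b).prodMk (hm (!b))) hT).symm
  have := Measure.isProbabilityMeasure_map (μ := P) (hm (!b)).aemeasurable
  rw [h1, h, Measure.prod_apply hT, lintegral_map (measurable_measure_prodMk_left hT) (hm b)]
  refine lintegral_congr fun ω => ?_
  rw [Measure.map_apply (hm (!b)) (measurable_prodMk_left hT)]
  rfl

/-- Once the nearest distance of type `b` is frozen, the crossover is a fixed finite number, and the
other nearest distance has no finite atom. -/
theorem IsDownlinkNetwork.ae_ne_crossDist (hN : IsDownlinkNetwork P p N) (b : Bool) :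
    ∀ᵐ ω ∂P, N.nearest (!b) ω ≠ ENNReal.ofReal (p.crossDist b (N.nearest b ω).toReal) := by
  have hT : MeasurableSet {x : ℝ≥0∞ × ℝ≥0∞ | x.2 = ENNReal.ofReal (p.crossDist b x.1.toReal)} :=
    measurableSet_eq_fun measurable_snd
      ((p.measurable_crossDist b).comp measurable_fst.ennreal_toReal).ennreal_ofReal
  have := hN.measure_nearest_pair b hT
  simp only [mem_ofPred_eq, hN.measure_nearest_eq_ofReal (!b) (p.crossDist_nonneg b _),
    lintegral_zero] at this
  exact measure_eq_zero_iff_ae_notMem.1 this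

/-- With the nearest distance of type `b` frozen at `r`, the other type fails to win with its void
probability up to the crossover; integrating over the law of `r` gives the product density. -/
theorem IsDownlinkNetwork.measure_nearestWins (hN : IsDownlinkNetwork P p N) (b : Bool)
    {B : Set ℝ} (hB : MeasurableSet B) :
    P (N.nearestWins p b B) = ∫⁻ r in B ∩ Ici 0,
      ENNReal.ofReal (p.voidLink (!b) (p.crossDist b r) * p.nearestDensity b r) := by
  set h : ℝ → ℝ≥0∞ := fun r => ENNReal.ofReal (p.voidLink (!b) (p.crossDist b r)) with hh
  have hhm : Measurable h :=
    ((p.continuous_voidLink (!b)).measurable.comp (p.measurable_crossDist b)).ennreal_ofReal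
  have hS : MeasurableSet {ω | N.nearest b ω ≠ ∞} :=
    (hN.measurable_nearest b (measurableSet_singleton _)).compl
  have hT : MeasurableSet {x : ℝ≥0∞ × ℝ≥0∞ | x.1 ≠ ∞ ∧ x.1.toReal ∈ B ∧
      ENNReal.ofReal (p.crossDist b x.1.toReal) ≤ x.2} :=
    ((measurable_fst (measurableSet_singleton _)).compl).inter
      ((measurable_fst.ennreal_toReal hB).inter
        (measurableSet_le ((p.measurable_crossDist b).comp
          measurable_fst.ennreal_toReal).ennreal_ofReal measurable_snd))
  have h1 := hN.measure_nearest_pair b hT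
  have h2 : ∀ ω, P {ω' | (N.nearest b ω, N.nearest (!b) ω') ∈ {x : ℝ≥0∞ × ℝ≥0∞ | x.1 ≠ ∞ ∧
      x.1.toReal ∈ B ∧ ENNReal.ofReal (p.crossDist b x.1.toReal) ≤ x.2}} =
      {ω | N.nearest b ω ≠ ∞}.indicator (fun ω => B.indicator h (N.nearest b ω).toReal) ω := by
    intro ω
    by_cases hω : N.nearest b ω = ∞
    · simp [hω]
    · by_cases hωB : (N.nearest b ω).toReal ∈ B
      · have := hN.measure_le_nearest (!b) (p.crossDist_nonneg b (N.nearest b ω).toReal)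
        simp only [mem_ofPred_eq, ne_eq, hω, not_false_eq_true, hωB, true_and]
        rw [indicator_of_mem (by exact hω), indicator_of_mem hωB, hh]
        exact this
      · simp [hω, hωB]
  simp_rw [h2] at h1
  rw [lintegral_indicator hS, ← lintegral_map (hhm.indicator hB)
    (hN.measurable_nearest b).ennreal_toReal, hN.map_nearest b,
    lintegral_withDensity_eq_lintegral_mul _ (p.continuous_nearestDensity b).measurable.ennreal_ofReal
      (hhm.indicator hB)] at h1
  rw [show N.nearestWins p b B = _ from rfl]
  refine Eq.trans h1 ?_
  rw [← Measure.restrict_restrict hB, ← lintegral_indicator hB]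
  refine lintegral_congr fun r => ?_
  by_cases hr : r ∈ B
  · simp only [Pi.mul_apply, indicator_of_mem hr, hh]
    rw [ENNReal.ofReal_mul (p.voidLink_pos _ _).le, mul_comm]
  · simp [hr]

/-- The joint law of the distance and the type of the serving link. -/
theorem IsDownlinkNetwork.measure_servDist_servLoS (hN : IsDownlinkNetwork P p N) (b : Bool)
    {B : Set ℝ} (hB : MeasurableSet B) :
    P {ω | N.servDist p ω ∈ B ∧ N.servLoS p ω = b} = ∫⁻ r in B ∩ Ici 0,
      ENNReal.ofReal (p.voidLink (!b) (p.crossDist b r) * p.nearestDensity b r) := by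
  rw [← hN.measure_nearestWins b hB]
  have h0 : ∀ᵐ ω ∂P, N.nearest b ω ≠ 0 := by
    have := hN.measure_nearest_eq_ofReal b le_rfl
    rw [ENNReal.ofReal_zero] at this
    exact measure_eq_zero_iff_ae_notMem.1 this
  refine measure_congr ?_
  filter_upwards [hN.ae_dist_pos, hN.ae_exists_isStrongest, h0, hN.ae_ne_crossDist b]
    with ω h1 h2 h3 h4
  exact propext (Network.mem_nearestWins_iff h1 h2 h3 h4).symm

end

/-! ### Identification of the densities and the split at `d1` -/

namespace NetParams

variable (p : NetParams)

theorem measurable_gain : Measurable p.gain := by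
  have h : Measurable p.gainVdB := by
    unfold gainVdB
    refine Measurable.ite (measurableSet_eq_fun (by fun_prop) measurable_const) measurable_const ?_
    simp only [Real.logb]
    fun_prop
  unfold gain
  exact measurable_const.pow (((measurable_const.add (h.comp
    (Real.measurable_arctan.comp (measurable_const.div measurable_id)))).add
      measurable_const).div_const _)

/-- The density of the serving distance over serving links of type `b`. -/
def servDensity (b : Bool) (r : ℝ) : ℝ :=
  p.voidLink (!b) (p.crossDist b r) * p.nearestDensity b r

theorem measurable_servDensity (b : Bool) : Measurable (p.servDensity b) :=
  ((p.continuous_voidLink _).measurable.comp (p.measurable_crossDist b)).mul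
    (p.continuous_nearestDensity b).measurable

theorem prL_eq_zero {r : ℝ} (hr : p.d1 < r) : p.prL r = 0 := by
  have h : p.d1 < p.dist3 r :=
    hr.trans_le (Real.le_sqrt_of_sq_le (le_add_of_nonneg_right (sq_nonneg p.L)))
  rw [prL, if_neg (not_le.2 h)]

theorem servDensity_true (r : ℝ) : p.servDensity true r = p.fL1 r := by
  simp only [servDensity, nearestDensity, fL1, crossDist, Bool.not_true, voidLink_true,
    voidLink_false, prLink, if_true]
  ring

theorem servDensity_false (r : ℝ) : p.servDensity false r = p.fNL1 r := by
  simp only [servDensity, nearestDensity, fNL1, crossDist, Bool.not_false, voidLink_true,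
    voidLink_false, prLink, Bool.false_eq_true, if_false]
  ring

theorem Ici_zero_eq : Ici (0 : ℝ) = Icc 0 p.d1 ∪ Ioi p.d1 :=
  (Icc_union_Ioi_eq_Ici p.d1_pos.le).symm

/-- The weight `f` serves two purposes: `f = 1` yields the laws of the serving distance, and the
conditional coverage probability yields the coverage formula. -/
theorem setLIntegral_servDensity (b : Bool) {B : Set ℝ} (hB : MeasurableSet B) (f : ℝ → ℝ≥0∞) :
    ∫⁻ r in B ∩ Ici 0, f r * ENNReal.ofReal (p.servDensity b r) =
      (∫⁻ r in B ∩ Icc 0 p.d1, f r * ENNReal.ofReal (p.servDensity b r)) +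
        ∫⁻ r in B ∩ Ioi p.d1, f r * ENNReal.ofReal (p.servDensity b r) := by
  rw [p.Ici_zero_eq, inter_union_distrib_left, lintegral_union (hB.inter measurableSet_Ioi)]
  exact disjoint_left.2 fun x h1 h2 => not_lt.2 h1.2.2 h2.2

theorem setLIntegral_servDensity_true {B : Set ℝ} (hB : MeasurableSet B) (f : ℝ → ℝ≥0∞) :
    ∫⁻ r in B ∩ Ici 0, f r * ENNReal.ofReal (p.servDensity true r) =
      ∫⁻ r in B ∩ Icc 0 p.d1, f r * ENNReal.ofReal (p.fL1 r) := by
  rw [p.setLIntegral_servDensity true hB, setLIntegral_congr_fun (s := B ∩ Ioi p.d1)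
    (g := fun _ => 0) (hB.inter measurableSet_Ioi)]
  · simp only [lintegral_zero, add_zero, servDensity_true]
  · intro r hr
    simp [servDensity_true, fL1, p.prL_eq_zero hr.2]

theorem setLIntegral_servDensity_false {B : Set ℝ} (hB : MeasurableSet B) (f : ℝ → ℝ≥0∞) :
    ∫⁻ r in B ∩ Ici 0, f r * ENNReal.ofReal (p.servDensity false r) =
      (∫⁻ r in B ∩ Icc 0 p.d1, f r * ENNReal.ofReal (p.fNL1 r)) +
        ∫⁻ r in B ∩ Ioi p.d1, f r * ENNReal.ofReal (p.fNL2 r) := by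
  rw [p.setLIntegral_servDensity false hB]
  simp only [servDensity_false]
  congr 1
  refine setLIntegral_congr_fun (hB.inter measurableSet_Ioi) fun r hr => ?_
  simp [fNL1, fNL2, p.prL_eq_zero hr.2]

end NetParams

/-! ### Measurability at the serving BS and disintegration of coverage -/

namespace Network

variable {Ω : Type*} {N : Network Ω} {p : NetParams}

/-- Expresses the serving index through countably many strongest-BS events, for measurability. The
second alternative reflects that the infimum of the empty set of naturals is 0. -/
theorem serving_eq_iff {ω : Ω} {n : ℕ} : N.serving p ω = n ↔
    (N.IsStrongest p n ω ∧ ∀ m < n, ¬ N.IsStrongest p m ω) ∨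
      (n = 0 ∧ ∀ m, ¬ N.IsStrongest p m ω) := by
  constructor
  · rintro rfl
    by_cases h : ∃ i, N.IsStrongest p i ω
    · exact Or.inl ⟨isStrongest_serving h, fun m hm => Nat.notMem_of_lt_sInf hm⟩
    · push Not at h
      refine Or.inr ⟨?_, h⟩
      rw [serving, Nat.sInf_eq_zero]
      exact Or.inr (eq_empty_iff_forall_notMem.2 h)
  · rintro (⟨h1, h2⟩ | ⟨rfl, h⟩)
    · refine le_antisymm (Nat.sInf_le h1) ?_
      by_contra! hlt
      exact h2 _ hlt (isStrongest_serving ⟨n, h1⟩)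
    · rw [serving, Nat.sInf_eq_zero]
      exact Or.inr (eq_empty_iff_forall_notMem.2 h)

theorem interf_true_add_interf_false (ω : Ω) : N.interf p true ω + N.interf p false ω =
    open Classical in
    ∑' i : ℕ, if i ≠ N.serving p ω then ENNReal.ofReal (N.rxPower p i ω) else 0 := by
  classical
  rw [interf, interf, ← ENNReal.tsum_add]
  refine tsum_congr fun i => ?_
  cases h : N.los i ω <;> by_cases hi : i = N.serving p ω <;> simp [hi]

theorem sinr_eq_sinrOf (ω : Ω) : N.sinr p ω = N.sinrOf p (N.servLoS p ω) ω := by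
  rw [sinr, sinrOf, interf_true_add_interf_false]
  rfl

end Network

section

variable {Ω : Type*} [MeasurableSpace Ω] {P : Measure Ω} {p : NetParams} {N : Network Ω}

theorem IsDownlinkNetwork.measurable_dist (hN : IsDownlinkNetwork P p N) (i : ℕ) :
    Measurable (N.dist i) := (hN.measurable_pos i).norm

theorem IsDownlinkNetwork.measurable_linkZeta (hN : IsDownlinkNetwork P p N) (i : ℕ) :
    Measurable (N.linkZeta p i) :=
  (measurable_from_prod_countable_right (f := fun q : Bool × ℝ => p.zeta q.1 q.2)
    p.measurable_zeta).comp ((hN.measurable_los i).prodMk (hN.measurable_dist i))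

theorem IsDownlinkNetwork.measurableSet_isStrongest (hN : IsDownlinkNetwork P p N) (i : ℕ) :
    MeasurableSet {ω | N.IsStrongest p i ω} := by
  simp only [Network.isStrongest_iff, ofPred_forall]
  exact MeasurableSet.iInter fun j =>
    measurableSet_le (hN.measurable_linkZeta j) (hN.measurable_linkZeta i)

theorem IsDownlinkNetwork.measurable_serving (hN : IsDownlinkNetwork P p N) :
    Measurable (N.serving p) := by
  refine measurable_to_countable' fun n => ?_
  have h := fun m => hN.measurableSet_isStrongest (p := p) m
  have hs : N.serving p ⁻¹' {n} =
      ({ω | N.IsStrongest p n ω} ∩ ⋂ m ∈ Iio n, {ω | N.IsStrongest p m ω}ᶜ) ∪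
        ({_ω | n = 0} ∩ ⋂ m, {ω | N.IsStrongest p m ω}ᶜ) := by
    ext ω
    rw [mem_preimage, mem_singleton_iff, Network.serving_eq_iff]
    simp
  rw [hs]
  exact ((h n).inter (MeasurableSet.biInter (to_countable _) fun m _ => (h m).compl)).union
    ((MeasurableSet.const _).inter (MeasurableSet.iInter fun m => (h m).compl))

/-- The random index is measurable and takes countably many values, so evaluation at it is
measurable. -/
theorem IsDownlinkNetwork.measurable_at_serving (hN : IsDownlinkNetwork P p N) {β : Type*}
    [MeasurableSpace β] {f : ℕ → Ω → β} (hf : ∀ i, Measurable (f i)) :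
    Measurable fun ω => f (N.serving p ω) ω :=
  (measurable_from_prod_countable_right (f := fun q : ℕ × Ω => f q.1 q.2) hf).comp
    (hN.measurable_serving.prodMk measurable_id)

theorem IsDownlinkNetwork.measurable_servDist (hN : IsDownlinkNetwork P p N) :
    Measurable (N.servDist p) := hN.measurable_at_serving hN.measurable_dist

theorem IsDownlinkNetwork.measurable_servLoS (hN : IsDownlinkNetwork P p N) :
    Measurable (N.servLoS p) := hN.measurable_at_serving hN.measurable_los

theorem IsDownlinkNetwork.measurable_rxPower (hN : IsDownlinkNetwork P p N) (i : ℕ) :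
    Measurable (N.rxPower p i) :=
  ((measurable_const.mul (p.measurable_gain.comp (hN.measurable_dist i))).mul
    (hN.measurable_linkZeta i)).mul (hN.measurable_fading i)

theorem IsDownlinkNetwork.measurable_interf (hN : IsDownlinkNetwork P p N) (b : Bool) :
    Measurable (N.interf p b) := by
  refine Measurable.tsum fun i => Measurable.ite ?_
    (hN.measurable_rxPower i).ennreal_ofReal measurable_const
  exact (measurableSet_eq_fun measurable_const hN.measurable_serving).compl.inter
    (hN.measurable_los i (measurableSet_singleton b))

theorem IsDownlinkNetwork.measurable_sinrOf (hN : IsDownlinkNetwork P p N) (b : Bool) :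
    Measurable (N.sinrOf p b) := by
  refine Measurable.div (Measurable.ennreal_ofReal ?_)
    (((hN.measurable_interf true).add (hN.measurable_interf false)).add measurable_const)
  exact ((measurable_const.mul (p.measurable_gain.comp hN.measurable_servDist)).mul
    ((p.measurable_zeta b).comp hN.measurable_servDist)).mul
      (hN.measurable_at_serving hN.measurable_fading)

variable [IsProbabilityMeasure P]

theorem IsDownlinkNetwork.map_servDist (hN : IsDownlinkNetwork P p N) (b : Bool) :
    (P.restrict {ω | N.servLoS p ω = b}).map (N.servDist p) =
      (volume.restrict (Ici 0)).withDensity fun r => ENNReal.ofReal (p.servDensity b r) := by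
  ext B hB
  rw [Measure.map_apply hN.measurable_servDist hB,
    Measure.restrict_apply (hN.measurable_servDist hB), withDensity_apply _ hB,
    Measure.restrict_restrict hB]
  exact hN.measure_servDist_servLoS b hB

/-- Disintegration of the coverage event along the serving distance. -/
theorem IsDownlinkNetwork.measure_sinr_inter_servLoS (hN : IsDownlinkNetwork P p N) (γ : ℝ)
    (b : Bool) :
    P ({ω | ENNReal.ofReal γ < N.sinr p ω} ∩ {ω | N.servLoS p ω = b}) =
      ∫⁻ r in Ici 0, N.condCov p P γ b r * ENNReal.ofReal (p.servDensity b r) := by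
  have hX : Measurable fun ω => (N.servDist p ω, N.servLoS p ω) :=
    hN.measurable_servDist.prodMk hN.measurable_servLoS
  have hcond : Measurable (N.condCov p P γ b) :=
    (Kernel.measurable_coe (condDistrib (N.sinrOf p b)
      (fun ω => (N.servDist p ω, N.servLoS p ω)) P) measurableSet_Ioi).comp measurable_prodMk_right
  have hS : MeasurableSet {ω | N.servLoS p ω = b} :=
    hN.measurable_servLoS (measurableSet_singleton b)
  have h := setLIntegral_preimage_condDistrib (μ := P) hX (hN.measurable_sinrOf (p := p) b).aemeasurable
    (measurableSet_Ioi (a := ENNReal.ofReal γ)) (MeasurableSet.univ.prod (measurableSet_singleton b))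
  have hpre : (fun ω => (N.servDist p ω, N.servLoS p ω)) ⁻¹' (univ ×ˢ {b}) =
      {ω | N.servLoS p ω = b} := by
    ext; simp
  have hset : {ω | ENNReal.ofReal γ < N.sinr p ω} ∩ {ω | N.servLoS p ω = b} =
      {ω | N.servLoS p ω = b} ∩ N.sinrOf p b ⁻¹' Ioi (ENNReal.ofReal γ) := by
    ext ω
    simp only [mem_inter_iff, mem_ofPred_eq, mem_preimage, mem_Ioi, Network.sinr_eq_sinrOf]
    rw [and_comm]
    exact and_congr_right fun h => by rw [h]
  -- On the event of type `b` the conditional probability depends on the serving distance alone, so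
  -- the integral passes to the law of that distance.
  rw [hset, ← hpre, ← h, hpre, setLIntegral_congr_fun (g := fun ω =>
    N.condCov p P γ b (N.servDist p ω)) hS fun ω hω => by
      have hω' : N.servLoS p ω = b := hω
      simp only [Network.condCov, hω'], ← lintegral_map hcond hN.measurable_servDist,
    hN.map_servDist b, lintegral_withDensity_eq_lintegral_mul _
      (p.measurable_servDensity b).ennreal_ofReal hcond]
  exact lintegral_congr fun r => mul_comm _ _

end

end

theorem theorem1 {Ω : Type*} [MeasurableSpace Ω] (P : Measure Ω) [IsProbabilityMeasure P]
    (p : NetParams) (N : Network Ω) (hN : IsDownlinkNetwork P p N) (γ : ℝ) (hγ : 0 < γ) :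
    -- almost surely there is a strongest BS
    (∀ᵐ ω ∂P, ∃ i, N.IsStrongest p i ω) ∧
    -- the densities of the serving distance over LoS and over NLoS serving links
    (∀ B : Set ℝ, MeasurableSet B →
      P {ω | N.servDist p ω ∈ B ∧ N.servLoS p ω = true} =
        ∫⁻ r in B ∩ Icc 0 p.d1, ENNReal.ofReal (p.fL1 r)) ∧
    (∀ B : Set ℝ, MeasurableSet B →
      P {ω | N.servDist p ω ∈ B ∧ N.servLoS p ω = false} =
        (∫⁻ r in B ∩ Icc 0 p.d1, ENNReal.ofReal (p.fNL1 r)) +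
        ∫⁻ r in B ∩ Ioi p.d1, ENNReal.ofReal (p.fNL2 r)) ∧
    -- the coverage probability
    N.pcov p P γ =
      (∫⁻ r in Icc 0 p.d1, N.condCov p P γ true r * ENNReal.ofReal (p.fL1 r)) +
      (∫⁻ r in Icc 0 p.d1, N.condCov p P γ false r * ENNReal.ofReal (p.fNL1 r)) +
      ∫⁻ r in Ioi p.d1, N.condCov p P γ false r * ENNReal.ofReal (p.fNL2 r) := by
  refine ⟨hN.ae_exists_isStrongest, fun B hB => ?_, fun B hB => ?_, ?_⟩
  · have := p.setLIntegral_servDensity_true hB 1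
    simp only [Pi.one_apply, one_mul] at this
    rw [← this]
    exact hN.measure_servDist_servLoS true hB
  · have := p.setLIntegral_servDensity_false hB 1
    simp only [Pi.one_apply, one_mul] at this
    rw [← this]
    exact hN.measure_servDist_servLoS false hB
  · have hS : MeasurableSet {ω | N.servLoS p ω = true} :=
      hN.measurable_servLoS (measurableSet_singleton true)
    have hcompl : {ω | N.servLoS p ω = true}ᶜ = {ω | N.servLoS p ω = false} := by
      ext; simp
    have ht := p.setLIntegral_servDensity_true MeasurableSet.univ (N.condCov p P γ true)
    have hf := p.setLIntegral_servDensity_false MeasurableSet.univ (N.condCov p P γ false)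
    simp only [univ_inter] at ht hf
    rw [Network.pcov, ← measure_inter_add_sdiff _ hS, sdiff_eq, hcompl,
      hN.measure_sinr_inter_servLoS, hN.measure_sinr_inter_servLoS, ht, hf, add_assoc]
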